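/- **Setting.** Let $\mathbb F_q\subseteq\mathbb F_{q^m}\subseteq\mathbb F_{q^{m\eta}}$ be finite fields, let $n,k,r$ be positive integers with $k\le n$, and let $0\le \ell<N$. The public data are a Rank-SD instance $H=(I\,\|\,H')\in\mathbb F_{q^m}^{(n-k)\times n}$, $y\in\mathbb F_{q^m}^{n-k}$; an $(\ell+1,N)$-threshold linear secret sharing scheme over $\mathbb F_q$ (for instance Shamir's), applied coordinatewise to $\mathbb F_q$-vector spaces, together with a public sharing $(u_1,\dots,u_N)\in\mathbb F_q^N$ of the constant $1$ (for Shamir's scheme all $u_i=1$); a commitment function $\mathsf{Com}$; a hash function $\mathsf H_M$ for Merkle trees; and a hash function $\mathsf H$. A *witness* is a vector $x\in\mathbb F_{q^m}^n$ with $Hx=y$ and rank weight $W_R(x)\le r$ over $\mathbb F_q$. **Protocol.** 1. The prover sends $h_0$, meant to be the Merkle root of commitments $\mathsf{Com}(\mathsf{state}_i,\rho_i)$, $1\le i\le N$, where $\mathsf{state}_i=([x_B]_i,[\beta]_i,[a]_i,[c]_i)$ is the share of party $i$ of some $x_B\in\mathbb F_{q^m}^k$, $\beta\in\mathbb F_{q^m}^{r-1}$,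 $a\in\mathbb F_{q^{m\eta}}^{r-1}$, $c\in\mathbb F_{q^{m\eta}}$. 2. The verifier sends uniformly random $\gamma_1,\dots,\gamma_n,e\in\mathbb F_{q^{m\eta}}$. 3. The prover sends a set $S$ of $\ell+1$ parties and a digest $h_1$, meant to be $\mathsf H(([\alpha]_i,[v]_i)_{i\in S})$, where, with $[x]_i=(u_iy-H'[x_B]_i\,\|\,[x_B]_i)$, $$[z]_i=-\sum_j\gamma_j([x_j]_i^{q^r}-[x_j]_i),\quad [\omega_s]_i=\sum_j\gamma_j([x_j]_i^{q^s}-[x_j]_i)\ (1\le s\le r-1),$$ $$[\alpha]_i=e\,[\omega]_i+[a]_i,\qquad [v]_i=e\,[z]_i-\langle\alpha,[\beta]_i\rangle-[c]_i ,$$ and $\alpha$ is the value reconstructed from the shares $[\alpha]_i$. 4. The verifier sends a uniformly random set $I$ of $\ell$ parties. 5. The prover sends $(\mathsf{state}_i,\rho_i)_{i\in I}$ with the Merkle authentication data, a party $i^*\in S\setminus I$ and $[\alpha]_{i^*}$. The verifier rebuilds the Merkle root from the openings; recomputes $[\alpha]_i$ for $i\in I$ and extends these together with $[\alpha]_{i^*}$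 to a full sharing of a value $\alpha$; recomputes $[v]_i$ for $i\in I$ and extends these to the sharing of $v=0$; and accepts iff the root equals $h_0$ and $\mathsf H(([\alpha]_i,[v]_i)_{i\in S})=h_1$. **Theorem.** Let $p=\frac{2}{q^{m\eta}}-\frac1{q^{2m\eta}}$ and $$\epsilon=\frac1{\binom N\ell}+p\cdot\frac{\ell\,(N-\ell)}{\ell+1},$$ and let $\tilde\epsilon>\epsilon$. There is a probabilistic extractor $\mathcal E$ with black-box rewinding access to provers with the following property. (In each call $\mathcal E$ runs the prover, against uniformly random challenges, on a fresh random tape, or rewound to the point just after its first message or just after its second message of an earlier call; $\mathcal E$ sees only the transcripts.) Every output of $\mathcal E$ is read off from accepted transcripts it has seen and is either * a commitment collision: openings $(m,\rho)$, $(m',\rho')$ with $m\ne m'$ and $\mathsf{Com}(m,\rho)=\mathsf{Com}(m',\rho')$, or two distinct inputs, evaluated in the verification of these transcripts, with the same value under $\mathsf H_M$ or under $\mathsf H$; or * a witness $x'=(y-H'x_B\,\|\,x_B)$ of the Rank-SD instance, where $x_B$ is reconstructed from shares that $\ell+1$ parties opened in runs on one and the same tape. For every prover $\tilde{\mathcal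 P}$ that convinces the honest verifier with probability exactly $\tilde\epsilon$, the expected number of calls to $\tilde{\mathcal P}$ that $\mathcal E$ makes until it outputs is at most $$\frac{4}{\tilde\epsilon-\epsilon}\left(1+\frac{8\,(N-\ell)}{\tilde\epsilon-\epsilon}\right)$$ (in particular, $\mathcal E$ produces an output with probability $1$). -/

import Mathlib

open scoped ENNReal

noncomputable section

namespace ThresholdRSD

/-! ### Threshold linear secret sharing -/

/-- A `(t, N)`-threshold linear secret sharing scheme over `F`.  The value of `reconstruct J` is
meaningful only for sets `J` of `t` parties. -/
structure ThresholdLSSS (F : Type*) [Field F] (t N : ℕ) where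
  /-- the randomness space -/
  Rnd : Type
  [rndFintype : Fintype Rnd]
  [rndNonempty : Nonempty Rnd]
  share : F → Rnd → Fin N → F
  reconstruct : (J : Finset (Fin N)) → (J → F) →ₗ[F] F
  correct : ∀ (s : F) (ρ : Rnd) (J : Finset (Fin N)), J.card = t →
    reconstruct J (fun j => share s ρ j) = s
  privacy : ∀ (s₀ s₁ : F) (I : Finset (Fin N)), I.card + 1 = t →
    (PMF.uniformOfFintype Rnd).map (fun ρ => fun i : I => share s₀ ρ i) =
      (PMF.uniformOfFintype Rnd).map (fun ρ => fun i : I => share s₁ ρ i)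

/-- Reconstruction of a secret in an `F`-vector space `V` from the shares of the parties of `J`:
the linear form `reconstruct J` is applied coordinate by coordinate, that is, its coefficients
act on the vectors. -/
def ThresholdLSSS.reconstructVec {F : Type*} [Field F] {t N : ℕ} (σ : ThresholdLSSS F t N)
    {V : Type*} [AddCommGroup V] [Module F V] (J : Finset (Fin N)) (x : Fin N → V) : V :=
  ∑ j : J, σ.reconstruct J (Pi.single j 1) • x j

/-- `x` is a (consistent) sharing of `s`: every set of `t` parties reconstructs `s`. -/
def ThresholdLSSS.IsSharingOf {F : Type*} [Field F] {t N : ℕ} (σ : ThresholdLSSS F t N)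
    {V : Type*} [AddCommGroup V] [Module F V] (x : Fin N → V) (s : V) : Prop :=
  ∀ J : Finset (Fin N), J.card = t → σ.reconstructVec J x = s

/-! ### Parameters, Rank-SD, public data -/

/-- The integer parameters: code length `n`, dimension `k`, rank bound `r`, number of parties `N`,
number `ℓ` of opened parties, length `lam` of the commitment randomness, digest length `d`. -/
structure Params where
  n : ℕ
  k : ℕ
  r : ℕ
  N : ℕ
  ℓ : ℕ
  lam : ℕ
  d : ℕ
  k_pos : 0 < k
  k_le_n : k ≤ n
  r_pos : 0 < r
  ℓ_lt_N : ℓ < N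

/-- Positions of a vector `x = (x_A ‖ x_B)` of length `n = (n - k) + k`. -/
abbrev Pos (P : Params) : Type := Fin (P.n - P.k) ⊕ Fin P.k

/-- Rank weight over `K` of a vector with entries in `L`: the rank of the matrix of its
coordinates in a `K`-basis of `L`. -/
def rankWeight (K : Type*) {L ι : Type*} [Field K] [Field L] [Algebra K L] [Module.Finite K L]
    [Fintype ι] (x : ι → L) : ℕ :=
  (Matrix.of fun i j => (Module.finBasis K L).repr (x i) j).rank

/-- The input share `([x_B], [β], [a], [c])` of one party.  The entry `j` of `β` and `a` has
number `j + 1` in `1, …, r - 1`. -/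
@[ext]
structure State (P : Params) (L M : Type*) where
  xB : Fin P.k → L
  β : Fin (P.r - 1) → L
  a : Fin (P.r - 1) → M
  c : M

/-- Bit strings of length `d`: the digests. -/
abbrev Digest (P : Params) : Type := List.Vector Bool P.d

/-- The random tape of a commitment. -/
abbrev Coins (P : Params) : Type := List.Vector Bool P.lam

/-- The values `([α]_i, [v]_i)` of `ℓ + 1` parties, listed in increasing order of the parties. -/
abbrev Broadcast (P : Params) (M : Type*) : Type _ :=
  Fin (P.ℓ + 1) → (Fin (P.r - 1) → M) × M

/-- Everything public: the instance `(H', y)` with `H = (I ‖ H')`, the secret sharing scheme with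
a public sharing of the constant `1` (all shares equal to `1` for Shamir's scheme), which is what
the parties use to add a public constant to a shared value, and the commitment and hash
functions. -/
structure PublicData (P : Params) (K L M : Type*) [Field K] where
  H' : Matrix (Fin (P.n - P.k)) (Fin P.k) L
  y : Fin (P.n - P.k) → L
  lsss : ThresholdLSSS K (P.ℓ + 1) P.N
  one : Fin P.N → K
  one_isSharing : lsss.IsSharingOf one 1
  /-- the commitment function -/
  com : State P L M → Coins P → List Bool
  /-- the hash function of the Merkle tree -/
  hashM : List Bool → Digest P
  /-- the hash function of the first response -/
  hash : Broadcast P M → Digest P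

section Protocol

variable {P : Params} {K L M : Type*} [Field K] [Field L] [Field M]

/-- `x` solves the Rank-SD instance: `H x = y` and the rank weight of `x` is at most `r`. -/
def IsWitness [Algebra K L] [Module.Finite K L] (D : PublicData P K L M) (x : Pos P → L) : Prop :=
  (Matrix.fromCols 1 D.H').mulVec x = D.y ∧ rankWeight K x ≤ P.r

/-- The vector `(u y - H' x_B ‖ x_B)`; here `u` is the share of the constant `1`. -/
def fullVec [Algebra K L] (D : PublicData P K L M) (u : K) (xB : Fin P.k → L) : Pos P → L :=
  Sum.elim (u • D.y - D.H'.mulVec xB) xB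

/-- The first challenge `((γ_j), ε)`. -/
abbrev Challenge₁ (P : Params) (M : Type*) : Type _ := (Pos P → M) × M

/-- The second challenge: a set of `ℓ` parties. -/
abbrev Challenge₂ (P : Params) : Type := {I : Finset (Fin P.N) // I.card = P.ℓ}

instance (P : Params) : Nonempty (Challenge₂ P) := by
  obtain ⟨s, -, hs⟩ := Finset.exists_subset_card_eq (s := (Finset.univ : Finset (Fin P.N)))
    (n := P.ℓ) (by simpa using P.ℓ_lt_N.le)
  exact ⟨⟨s, hs⟩⟩

/-! ### Local computation of a party -/

section Party

variable [Fintype K] [Algebra K L] [Algebra L M]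

/-- `[z]_i`. -/
def partyZ (D : PublicData P K L M) (ch : Challenge₁ P M) (i : Fin P.N) (st : State P L M) : M :=
  let x : Pos P → L := fullVec D (D.one i) st.xB;
  (-∑ j, ch.1 j * algebraMap L M (x j ^ Fintype.card K ^ P.r - x j))

/-- `[ω]_i`. -/
def partyω (D : PublicData P K L M) (ch : Challenge₁ P M) (i : Fin P.N) (st : State P L M) :
    Fin (P.r - 1) → M := fun e =>
  let x := fullVec D (D.one i) st.xB
  ∑ j, ch.1 j * algebraMap L M (x j ^ Fintype.card K ^ (e.1 + 1) - x j)

/-- `[α]_i`. -/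
def partyα (D : PublicData P K L M) (ch : Challenge₁ P M) (i : Fin P.N) (st : State P L M) :
    Fin (P.r - 1) → M :=
  ch.2 • partyω D ch i st + st.a

/-- `[v]_i`, once the opened value `α` is known. -/
def partyV (D : PublicData P K L M) (ch : Challenge₁ P M) (α : Fin (P.r - 1) → M) (i : Fin P.N)
    (st : State P L M) : M :=
  ch.2 * partyZ D ch i st - ∑ e, α e * algebraMap L M (st.β e) - st.c

end Party

/-! ### Merkle tree -/

open Classical in
/-- The hash at the node whose leaves are `lo, …, lo + len - 1`, rebuilt from the known leaf
values (`leaf i = some v`) and, for every subtree without a known leaf, from the transmitted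
digest `auth lo len`.  If all leaves are known this is the Merkle root of their list. -/
def rebuild {d : ℕ} (hashM : List Bool → List.Vector Bool d) (leaf : ℕ → Option (List Bool))
    (auth : ℕ → ℕ → List.Vector Bool d) (lo len : ℕ) : List.Vector Bool d :=
  if ∀ i, lo ≤ i → i < lo + len → leaf i = none then auth lo len
  else if len ≤ 1 then hashM ((leaf lo).getD [])
  else hashM ((rebuild hashM leaf auth lo (len / 2)).toList ++
    (rebuild hashM leaf auth (lo + len / 2) (len - len / 2)).toList)
termination_by len
decreasing_by all_goals omega

open Classical in
/-- The strings at which `hashM` is evaluated during the computation of `rebuild`. -/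
def rebuildInputs {d : ℕ} (hashM : List Bool → List.Vector Bool d) (leaf : ℕ → Option (List Bool))
    (auth : ℕ → ℕ → List.Vector Bool d) (lo len : ℕ) : Set (List Bool) :=
  if ∀ i, lo ≤ i → i < lo + len → leaf i = none then ∅
  else if len ≤ 1 then {(leaf lo).getD []}
  else {(rebuild hashM leaf auth lo (len / 2)).toList ++
      (rebuild hashM leaf auth (lo + len / 2) (len - len / 2)).toList} ∪
    (rebuildInputs hashM leaf auth lo (len / 2) ∪
      rebuildInputs hashM leaf auth (lo + len / 2) (len - len / 2))
termination_by len
decreasing_by all_goals omega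

/-! ### Messages and verification -/

/-- First response: the public set `S` of `ℓ + 1` parties and the digest `h₁`. -/
structure Response₁ (P : Params) where
  S : {S : Finset (Fin P.N) // S.card = P.ℓ + 1}
  h₁ : Digest P

/-- Second response to the set `I`: the opened states and commitment coins of the parties of `I`,
the authentication data (a digest for each node; only those of the maximal subtrees without a
leaf in `I` are used), the party `i*` and its share of `α`. -/
structure Response₂ (P : Params) (L M : Type*) (I : Challenge₂ P) where
  opening : {i // i ∈ I.1} → State P L M × Coins P
  auth : ℕ → ℕ → Digest P
  iStar : Fin P.N
  αStar : Fin (P.r - 1) → M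

structure Transcript (P : Params) (L M : Type*) where
  h₀ : Digest P
  ch₁ : Challenge₁ P M
  rsp₁ : Response₁ P
  ch₂ : Challenge₂ P
  rsp₂ : Response₂ P L M ch₂

open Classical in
/-- The commitment of party `i`, recomputed from its opening if `i` is an opened party. -/
def Transcript.leaf (D : PublicData P K L M) (T : Transcript P L M) (i : ℕ) :
    Option (List Bool) :=
  if h : ∃ hi : i < P.N, (⟨i, hi⟩ : Fin P.N) ∈ T.ch₂.1 then
    let o := T.rsp₂.opening ⟨⟨i, h.1⟩, h.2⟩
    some (D.com o.1 o.2)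
  else none

/-- `α` (a sharing of `α₀`) and `v` (a sharing of `0`) are the sharings that the verifier recovers
from the transcript: the shares of the opened parties are recomputed from their states, the share
of `α` of `i*` is the transmitted one. -/
def Transcript.Recovers [Fintype K] [Algebra K L] [Algebra L M] [Algebra K M]
    (D : PublicData P K L M) (T : Transcript P L M)
    (α₀ : Fin (P.r - 1) → M) (α : Fin P.N → Fin (P.r - 1) → M) (v : Fin P.N → M) : Prop :=
  D.lsss.IsSharingOf α α₀ ∧ D.lsss.IsSharingOf v 0 ∧
  (∀ i : {i // i ∈ T.ch₂.1}, α i = partyα D T.ch₁ i (T.rsp₂.opening i).1) ∧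
  α T.rsp₂.iStar = T.rsp₂.αStar ∧
  (∀ i : {i // i ∈ T.ch₂.1}, v i = partyV D T.ch₁ α₀ i (T.rsp₂.opening i).1)

/-- `b` is the tuple `([α]_i, [v]_i)_{i ∈ S}` to which the verifier applies `hash`. -/
def Transcript.HashInput [Fintype K] [Algebra K L] [Algebra L M] [Algebra K M]
    (D : PublicData P K L M) (T : Transcript P L M) (b : Broadcast P M) : Prop :=
  ∃ α₀ α v, T.Recovers D α₀ α v ∧
    b = fun j => (α (T.rsp₁.S.1.orderEmbOfFin T.rsp₁.S.2 j),
      v (T.rsp₁.S.1.orderEmbOfFin T.rsp₁.S.2 j))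

/-- The verifier accepts. -/
def Transcript.Accepted [Fintype K] [Algebra K L] [Algebra L M] [Algebra K M]
    (D : PublicData P K L M) (T : Transcript P L M) : Prop :=
  rebuild D.hashM (T.leaf D) T.rsp₂.auth 0 P.N = T.h₀ ∧
  T.rsp₂.iStar ∈ T.rsp₁.S.1 ∧ T.rsp₂.iStar ∉ T.ch₂.1 ∧
  ∃ b, T.HashInput D b ∧ D.hash b = T.rsp₁.h₁

/-! ### Provers -/

/-- An arbitrary (cheating) prover: its messages are functions of its random tape, which is drawn
uniformly, and of the challenges received so far. -/
structure Prover (P : Params) (L M : Type*) where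
  Tape : Type*
  [tapeFintype : Fintype Tape]
  [tapeNonempty : Nonempty Tape]
  commit : Tape → Digest P
  respond₁ : Tape → Challenge₁ P M → Response₁ P
  respond₂ : Tape → Challenge₁ P M → (I : Challenge₂ P) → Response₂ P L M I

attribute [instance] Prover.tapeFintype Prover.tapeNonempty

/-- The transcript of one execution. -/
def Prover.transcript (Q : Prover P L M) (ω : Q.Tape) (c : Challenge₁ P M) (I : Challenge₂ P) :
    Transcript P L M :=
  ⟨Q.commit ω, c, Q.respond₁ ω c, I, Q.respond₂ ω c I⟩

/-- The transcript of an execution with an honest verifier. -/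
def Prover.execution [Fintype M] (Q : Prover P L M) : PMF (Transcript P L M) :=
  (PMF.uniformOfFintype Q.Tape).bind fun ω =>
  (PMF.uniformOfFintype (Challenge₁ P M)).bind fun c =>
  (PMF.uniformOfFintype (Challenge₂ P)).map fun I => Q.transcript ω c I

/-- The probability that the prover convinces the honest verifier. -/
def Prover.acceptProb [Fintype K] [Fintype M] [Algebra K L] [Algebra L M] [Algebra K M]
    (D : PublicData P K L M) (Q : Prover P L M) : ℝ :=
  (Q.execution.toOuterMeasure {T | T.Accepted D}).toReal

/-! ### Extractors -/

/-- What an extractor produces: two openings, two strings for `hashM`, two arguments for `hash`,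
or a vector. -/
inductive Output (P : Params) (L M : Type*) where
  | comCollision (m m' : State P L M) (ρ ρ' : Coins P)
  | merkleCollision (u u' : List Bool)
  | hashCollision (b b' : Broadcast P M)
  | witness (x : Pos P → L)

/-- The output is a genuine collision of one of the commitment functions, or a genuine solution. -/
def Output.Valid [Algebra K L] [Module.Finite K L] (D : PublicData P K L M) :
    Output P L M → Prop
  | .comCollision m m' ρ ρ' => m ≠ m' ∧ D.com m ρ = D.com m' ρ'
  | .merkleCollision u u' => u ≠ u' ∧ D.hashM u = D.hashM u'
  | .hashCollision b b' => b ≠ b' ∧ D.hash b = D.hash b'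
  | .witness x => IsWitness D x

/-- What the extractor sees of one call to the prover: the transcript, the number of the session
(calls with the same random tape of the prover belong to the same session), and the memory `memo`
that the extractor wrote when it decided to make the call. -/
structure Call (P : Params) (L M : Type*) where
  session : ℕ
  memo : ℕ
  T : Transcript P L M

/-- The output is read off from the accepted transcripts among `h`: collisions consist of values
that were opened by the prover or hashed by the verifier, and a vector is
`(y - H' x_B ‖ x_B)` with `x_B` reconstructed from the shares that `ℓ + 1` parties opened in one
session.  (Collisions exist for every compressing function, and a solution may exist without
being known, so this is what makes extraction meaningful.) -/
def Output.ReadOff [Fintype K] [Algebra K L] [Algebra L M] [Algebra K M]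
    (D : PublicData P K L M) (h : List (Call P L M)) : Output P L M → Prop
  | .comCollision m m' ρ ρ' => ∀ o ∈ [(m, ρ), (m', ρ')], ∃ C ∈ h, C.T.Accepted D ∧
      ∃ i, C.T.rsp₂.opening i = o
  | .merkleCollision u u' => ∀ w ∈ [u, u'], ∃ C ∈ h, C.T.Accepted D ∧
      w ∈ rebuildInputs D.hashM (C.T.leaf D) C.T.rsp₂.auth 0 P.N
  | .hashCollision b b' => ∀ w ∈ [b, b'], ∃ C ∈ h, C.T.Accepted D ∧ C.T.HashInput D w
  | .witness x => ∃ (s : ℕ) (J : Finset (Fin P.N)) (st : Fin P.N → State P L M),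
      J.card = P.ℓ + 1 ∧
      (∀ i ∈ J, ∃ C ∈ h, C.session = s ∧ C.T.Accepted D ∧
        ∃ hi : i ∈ C.T.ch₂.1, (C.T.rsp₂.opening ⟨i, hi⟩).1 = st i) ∧
      x = fullVec D 1 (D.lsss.reconstructVec J fun i => (st i).xB)

/-- How the next call to the prover is made: on a fresh tape; on the tape of call number `j`,
rewound to the moment after its commitment (new challenges are drawn); or on the tape of call
number `j`, rewound to the moment after its first response (only a new second challenge is
drawn). -/
inductive Move where
  | fresh
  | rewindCommit (j : ℕ)
  | rewindResponse (j : ℕ)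

/-- An extractor with black-box rewinding access: it sees the calls made so far, decides at random
how to make the next one (and what to remember of this decision), and stops as soon as it has an
output.  It has no other access to the prover. -/
structure Extractor (P : Params) (L M : Type*) where
  next : List (Call P L M) → PMF (ℕ × Move)
  out : List (Call P L M) → Option (Output P L M)

/-- The next call, made on tape `ω` in session `s` with memory `a`; the first challenge is `c?` if it is given, and
uniformly random otherwise; the second challenge is uniformly random. -/
def Prover.call [Fintype M] (Q : Prover P L M) (ω : Q.Tape) (s a : ℕ)
    (c? : Option (Challenge₁ P M)) : PMF (Q.Tape × Call P L M) :=
  (c?.elim (PMF.uniformOfFintype (Challenge₁ P M)) PMF.pure).bind fun c =>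
  (PMF.uniformOfFintype (Challenge₂ P)).map fun I => (ω, ⟨s, a, Q.transcript ω c I⟩)

/-- A call on a fresh uniformly random tape, in the session of number `s`. -/
def Prover.freshCall [Fintype M] (Q : Prover P L M) (s a : ℕ) : PMF (Q.Tape × Call P L M) :=
  (PMF.uniformOfFintype Q.Tape).bind fun ω => Q.call ω s a none

/-- Execution of a move after the calls `h` (kept with their tapes, which the extractor does not
see).  A move that refers to a call that was not made is executed as a fresh call. -/
def Prover.move [Fintype M] (Q : Prover P L M) (h : List (Q.Tape × Call P L M)) (a : ℕ) :
    Move → PMF (Q.Tape × Call P L M)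
  | .fresh => Q.freshCall h.length a
  | .rewindCommit j =>
    match h[j]? with
    | some (ω, C) => Q.call ω C.session a none
    | none => Q.freshCall h.length a
  | .rewindResponse j =>
    match h[j]? with
    | some (ω, C) => Q.call ω C.session a (some C.T.ch₁)
    | none => Q.freshCall h.length a

/-- The distribution of the list of calls after at most `t` calls; nothing is added any more once
the extractor has an output. -/
def Extractor.run [Fintype M] (E : Extractor P L M) (Q : Prover P L M) :
    ℕ → PMF (List (Q.Tape × Call P L M))
  | 0 => PMF.pure []
  | t + 1 => (E.run Q t).bind fun h =>
    match E.out (h.map Prod.snd) with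
    | some _ => PMF.pure h
    | none => (E.next (h.map Prod.snd)).bind fun μ => (Q.move h μ.1 μ.2).map fun C => h ++ [C]

/-- The expected number of calls to the prover: the sum over `t` of the probability that there is
no output after `t` calls, so that call number `t + 1` is made. -/
def Extractor.expectedCalls [Fintype M] (E : Extractor P L M) (Q : Prover P L M) : ℝ≥0∞ :=
  ∑' t, (E.run Q t).toOuterMeasure {h | E.out (h.map Prod.snd) = none}

/-- All outputs of the extractor are correct, and are read off from the transcripts seen. -/
def Extractor.Correct [Fintype K] [Algebra K L] [Module.Finite K L] [Algebra L M] [Algebra K M]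
    (D : PublicData P K L M) (E : Extractor P L M) : Prop :=
  ∀ h o, E.out h = some o → o.Valid D ∧ o.ReadOff D h

end Protocol

/-! ### Constants -/

/-- The false positive rate `2 / q^(mη) - 1 / q^(2mη)` of the multi-party protocol. -/
def falsePositiveRate (K L M : Type*) [Fintype K] [Field K] [Field L] [Field M] [Algebra K L]
    [Algebra L M] : ℝ :=
  2 / (Fintype.card K : ℝ) ^ (Module.finrank K L * Module.finrank L M) -
    1 / (Fintype.card K : ℝ) ^ (2 * (Module.finrank K L * Module.finrank L M))

/-- The soundness error `1 / binom(N, ℓ) + p ℓ (N - ℓ) / (ℓ + 1)`. -/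
def soundnessError (N ℓ : ℕ) (p : ℝ) : ℝ :=
  1 / (N.choose ℓ : ℝ) + p * ((ℓ : ℝ) * ((N : ℝ) - ℓ) / ((ℓ : ℝ) + 1))

end ThresholdRSD

end

/-! As long as no commitment or hash collision can be read off, a session (all calls on one tape)
behaves rigidly. The Merkle root depends only on the tape, so each party has at most one opened
state. Two accepted runs with the same first challenge and first response recover the same sharings
of `α` and `v`: they agree on the `ℓ + 1` parties of `S`, and by privacy `ℓ + 1` shares determine
all the others.

Fix an accepted call with first challenge `c`. An accepted set `I` that gives no output and opens no
new party lies in the set `G` of opened parties whose states fit these sharings. Every `(ℓ +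
1)`-subset of `G` reconstructs a state that passes the multi-party computation at `c`, although its
vector has rank weight above `r`, since otherwise it would be a witness. So there are at most
`binom(|G|, ℓ) ≤ 1 + ℓ binom(|G|, ℓ + 1) ≤ m(c)` such sets, where `m(c)` is `1 + ℓ` times the number
of false positives at `c` (`card_not_progress_le`). For a fixed state of too large rank, the monic
linearized polynomial with coefficients `β` and `q`-degree `r` does not vanish at all coordinates.
Passing is then an equation `e φ(γ) = t` with a linear form `φ ≠ 0`, of probability at most `p`
(`card_mpcAccepts_le`). Averaging over `c`, the mean of `m` is at most `1 + ℓ p binom(N, ℓ + 1) =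
binom(N, ℓ) ε` (`sum_falsePositives_le`).

A round draws a new first challenge and, if the call is accepted, repeats that challenge until the
next acceptance, which is uniform among the accepted `I`. On a tape with acceptance probability `τ`,
a round therefore makes progress (an output or a new party) with probability at least `g = max (τ -
ε) 0`, and costs at most `2` calls on average (`Prover.expect_round_le`). If a session is given up
with probability `μ / (1 + μ)` before each call with a new first challenge, progress comes before
surrender with probability at least `ρ = g / (g + μ)`. With `n` parties unopened, `n + 1` steps of
progress suffice: `n` new parties, then an output.

This suggests the potential `A + B (1 - ρ ^ (n + 1))`: `A = 2 / μ` pays for the rounds, and `B` for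
a new session if this one is lost. It drops by at least `1` per call on average
(`one_add_mean_potential_le`), so the expected number of calls is at most its initial value `B`
(`Extractor.expectedCalls_le`). It remains to see that a fresh session is worth at most `B` on
average over tapes (`expect_session_le`). Put `k = N - ℓ`, `δ = ε' - ε` and `μ = δ / (2k)`. Then `g
> δ / 2` forces `ρ ^ k ≥ 1 / e`, so the average gain is at least `B δ / (2e)`, which covers the
costs for `B = (4 / δ) (1 + 8k / δ)`. -/

noncomputable section

namespace ThresholdRSD

open scoped BigOperators

/-! ### Linear secret sharing -/

namespace ThresholdLSSS

variable {F : Type*} [Field F] {t N : ℕ} (σ : ThresholdLSSS F t N)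

/-- The coefficient of party `j` in the reconstruction from the parties of `J`. -/
def coeff (J : Finset (Fin N)) (j : Fin N) : F :=
  if h : j ∈ J then σ.reconstruct J (Pi.single ⟨j, h⟩ 1) else 0

theorem reconstructVec_eq_sum {V : Type*} [AddCommGroup V] [Module F V] (J : Finset (Fin N))
    (x : Fin N → V) : σ.reconstructVec J x = ∑ j ∈ J, σ.coeff J j • x j := by
  rw [reconstructVec, ← Finset.sum_coe_sort J]
  exact Finset.sum_congr rfl fun j _ => by simp [coeff]

theorem reconstruct_eq_sum (J : Finset (Fin N)) (x : Fin N → F) :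
    σ.reconstruct J (fun j => x j) = ∑ j ∈ J, σ.coeff J j * x j := by
  have h : (fun j : J => x j) = ∑ j : J, x j • (Pi.single j 1 : J → F) := by
    ext i
    simp [Finset.sum_apply, Pi.single_apply]
  rw [h, map_sum, ← Finset.sum_coe_sort J]
  exact Finset.sum_congr rfl fun j _ => by simp [coeff, mul_comm]

/-- Privacy forces every party of a reconstructing set to contribute. -/
theorem coeff_ne_zero {J : Finset (Fin N)} (hJ : J.card = t) {i : Fin N} (hi : i ∈ J) :
    σ.coeff J i ≠ 0 := by
  intro h0
  let _ := σ.rndFintype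
  have _ := σ.rndNonempty
  have hcard : (J.erase i).card + 1 = t := by rw [Finset.card_erase_add_one hi, hJ]
  have hp := σ.privacy 0 1 (J.erase i) hcard
  obtain ⟨ρ₀⟩ := σ.rndNonempty
  -- With a zero coefficient at `i`, the other `t - 1` shares would determine the secret. By
  -- privacy, what these parties hold in a sharing of `0` also occurs in some sharing of `1`.
  have hmem : (fun j : J.erase i => σ.share 0 ρ₀ j) ∈
      ((PMF.uniformOfFintype σ.Rnd).map
        (fun ρ => fun i : J.erase i => σ.share 1 ρ i)).support := by
    rw [← hp, PMF.mem_support_map_iff]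
    exact ⟨ρ₀, by simp, rfl⟩
  rw [PMF.mem_support_map_iff] at hmem
  obtain ⟨ρ₁, -, h₁⟩ := hmem
  have e₀ := σ.correct 0 ρ₀ J hJ
  have e₁ := σ.correct 1 ρ₁ J hJ
  rw [σ.reconstruct_eq_sum J (σ.share 0 ρ₀)] at e₀
  rw [σ.reconstruct_eq_sum J (σ.share 1 ρ₁)] at e₁
  refine one_ne_zero (α := F) ?_
  rw [← e₁, ← e₀]
  refine Finset.sum_congr rfl fun j hj => ?_
  by_cases hji : j = i
  · rw [hji, h0, zero_mul, zero_mul]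
  · have := congrFun h₁ ⟨j, Finset.mem_erase.2 ⟨hji, hj⟩⟩
    simp only at this
    rw [this]

/-- For a party `i` outside `S`, exchange some `j ∈ S` for `i`: the new set reconstructs the same
secret and the coefficient of `i` is nonzero, so the share of `i` is determined. -/
theorem IsSharingOf.eq_of_eqOn {σ : ThresholdLSSS F (t + 1) N} {V : Type*} [AddCommGroup V]
    [Module F V] {x x' : Fin N → V} {s s' : V} (hx : σ.IsSharingOf x s)
    (hx' : σ.IsSharingOf x' s') {S : Finset (Fin N)} (hS : S.card = t + 1)
    (h : ∀ i ∈ S, x i = x' i) : s = s' ∧ x = x' := by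
  have hs : s = s' := by
    rw [← hx S hS, ← hx' S hS, reconstructVec_eq_sum, reconstructVec_eq_sum]
    exact Finset.sum_congr rfl fun j hj => by rw [h j hj]
  refine ⟨hs, funext fun i => ?_⟩
  by_cases hi : i ∈ S
  · exact h i hi
  obtain ⟨j, hj⟩ : S.Nonempty := Finset.card_pos.1 (by omega)
  have hi' : i ∉ S.erase j := fun h' => hi (Finset.mem_of_mem_erase h')
  have hcard : (insert i (S.erase j)).card = t + 1 := by
    rw [Finset.card_insert_of_notMem hi', Finset.card_erase_add_one hj, hS]
  have e := (hx _ hcard).trans (hs.trans (hx' _ hcard).symm)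
  rw [reconstructVec_eq_sum, reconstructVec_eq_sum, Finset.sum_insert hi',
    Finset.sum_insert hi', Finset.sum_congr rfl fun l hl => by
      rw [h l (Finset.mem_of_mem_erase hl)], add_left_inj] at e
  exact smul_right_injective V (σ.coeff_ne_zero hcard (Finset.mem_insert_self _ _)) e

theorem reconstructVec_apply {ι : Type*} {V : Type*} [AddCommGroup V] [Module F V]
    (J : Finset (Fin N)) (x : Fin N → ι → V) (i : ι) :
    σ.reconstructVec J x i = σ.reconstructVec J fun j => x j i := by
  simp [reconstructVec_eq_sum, Finset.sum_apply]

theorem reconstructVec_map {V W : Type*} [AddCommGroup V] [Module F V] [AddCommGroup W]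
    [Module F W] (φ : V →ₗ[F] W) (J : Finset (Fin N)) (x : Fin N → V) :
    (σ.reconstructVec J fun j => φ (x j)) = φ (σ.reconstructVec J x) := by
  simp [reconstructVec_eq_sum]

theorem reconstructVec_congr {V : Type*} [AddCommGroup V] [Module F V] {J : Finset (Fin N)}
    {x x' : Fin N → V} (h : ∀ j ∈ J, x j = x' j) :
    σ.reconstructVec J x = σ.reconstructVec J x' := by
  rw [reconstructVec_eq_sum, reconstructVec_eq_sum]
  exact Finset.sum_congr rfl fun j hj => by rw [h j hj]

theorem reconstructVec_add {V : Type*} [AddCommGroup V] [Module F V] (J : Finset (Fin N))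
    (x x' : Fin N → V) : (σ.reconstructVec J fun j => x j + x' j) =
      σ.reconstructVec J x + σ.reconstructVec J x' := by
  simp [reconstructVec_eq_sum, Finset.sum_add_distrib]

theorem reconstructVec_sub {V : Type*} [AddCommGroup V] [Module F V] (J : Finset (Fin N))
    (x x' : Fin N → V) : (σ.reconstructVec J fun j => x j - x' j) =
      σ.reconstructVec J x - σ.reconstructVec J x' := by
  simp [reconstructVec_eq_sum, smul_sub]

end ThresholdLSSS

/-! ### Linearized polynomials and rank -/

section Rank

variable (K : Type*) {L M ι : Type*} [Field K] [Fintype K] [Field L] [Field M] [Algebra K L]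

/-- The `K`-linear map `x ↦ x ^ q ^ s - x`. -/
def frobSub (s : ℕ) : L →ₗ[K] L :=
  ((FiniteField.frobeniusAlgHom K L) ^ s).toLinearMap - LinearMap.id

@[simp]
theorem frobSub_apply (s : ℕ) (x : L) : frobSub K s x = x ^ Fintype.card K ^ s - x := by
  simp [frobSub, AlgHom.coe_pow, FiniteField.coe_frobeniusAlgHom, pow_iterate]

/-- A nonzero linearized polynomial of `q`-degree `r` vanishes only on vectors of rank weight at
most `r`. -/
theorem rankWeight_le_of_linearized_eq_zero [Fintype L] [Fintype ι] {r : ℕ} (hr : 0 < r)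
    (β : Fin (r - 1) → L) (x : ι → L)
    (h : ∀ j, frobSub K r (x j) + ∑ e, β e * frobSub K (e.1 + 1) (x j) = 0) :
    rankWeight K x ≤ r := by
  classical
  set q := Fintype.card K with hq
  have hq1 : 1 < q := Fintype.one_lt_card
  let φ : L →ₗ[K] L :=
    frobSub K r + ∑ e : Fin (r - 1), (LinearMap.mulLeft K (β e)).comp (frobSub K (e.1 + 1))
  have hφ : ∀ y, φ y = frobSub K r y + ∑ e, β e * frobSub K (e.1 + 1) y := fun y => by
    simp [φ, LinearMap.sum_apply]
  let W : Submodule K L := Submodule.span K (Set.range x)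
  have hW : ∀ y ∈ W, φ y = 0 := by
    intro y hy
    have : W ≤ LinearMap.ker φ := by
      refine Submodule.span_le.2 ?_
      rintro _ ⟨j, rfl⟩
      exact LinearMap.mem_ker.2 ((hφ _).trans (h j))
    exact LinearMap.mem_ker.1 (this hy)
  -- The coordinate isomorphism carries `W` to the row space of the matrix.
  have hrank : rankWeight K x = Module.finrank K W := by
    rw [rankWeight, Matrix.rank_eq_finrank_span_row]
    let e := (Module.finBasis K L).equivFun
    have : Submodule.span K (Set.range
        (Matrix.of fun i j => (Module.finBasis K L).repr (x i) j).row) =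
        W.map (e : L →ₗ[K] _) := by
      rw [Submodule.map_span, ← Set.range_comp]
      rfl
    rw [this]
    exact LinearEquiv.finrank_map_eq e W
  -- The exponents `e + 1` stop at `r - 1`, so adding `X ^ q ^ r` gives a monic polynomial of degree
  -- `q ^ r`. It vanishes on all `q ^ dim W` elements of `W`, whence `dim W ≤ r`.
  let tail : Polynomial L := -Polynomial.X + ∑ e : Fin (r - 1), Polynomial.C (β e) *
    (Polynomial.X ^ q ^ (e.1 + 1) - Polynomial.X)
  have htail : tail.degree < (q ^ r : ℕ) := by
    have hX : (Polynomial.X : Polynomial L).degree < (q ^ r : ℕ) := by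
      rw [Polynomial.degree_X]
      exact_mod_cast Nat.one_lt_pow hr.ne' hq1
    refine lt_of_le_of_lt (Polynomial.degree_add_le _ _) (max_lt ?_ ?_)
    · rwa [Polynomial.degree_neg]
    · refine lt_of_le_of_lt (Polynomial.degree_sum_le _ _) ?_
      rw [Finset.sup_lt_iff (WithBot.bot_lt_coe _)]
      intro e _
      rw [← Polynomial.smul_eq_C_mul]
      refine lt_of_le_of_lt (Polynomial.degree_smul_le _ _) ?_
      refine lt_of_le_of_lt (Polynomial.degree_sub_le _ _) (max_lt ?_ hX)
      rw [Polynomial.degree_X_pow]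
      exact_mod_cast Nat.pow_lt_pow_right hq1 (by omega)
  let f : Polynomial L := Polynomial.X ^ q ^ r + tail
  have hmonic : f.Monic := Polynomial.monic_X_pow_add htail
  have hdeg : f.natDegree = q ^ r := by
    rw [Polynomial.natDegree_eq_of_degree_eq_some]
    rw [Polynomial.degree_add_eq_left_of_degree_lt, Polynomial.degree_X_pow]
    rwa [Polynomial.degree_X_pow]
  have hroot : ∀ y ∈ W, f.eval y = 0 := by
    intro y hy
    have := hW y hy
    rw [hφ] at this
    rw [← this]
    simp only [f, tail, Polynomial.eval_add, Polynomial.eval_pow, Polynomial.eval_X,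
      Polynomial.eval_neg, Polynomial.eval_finsetSum, Polynomial.eval_mul, Polynomial.eval_C,
      Polynomial.eval_sub, frobSub_apply]
    ring
  let Z : Finset L := Finset.univ.filter (· ∈ W)
  have hZ : Z.card = q ^ Module.finrank K W := by
    rw [hq, ← Module.card_eq_pow_finrank (K := K) (V := W), Fintype.card_subtype]
  have hle : Z.card ≤ f.natDegree := by
    refine Polynomial.card_le_degree_of_subset_roots fun y hy => ?_
    rw [Polynomial.mem_roots hmonic.ne_zero]
    exact hroot y (Finset.mem_filter.1 hy).2
  rw [hZ, hdeg] at hle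
  rw [hrank]
  exact (Nat.pow_le_pow_iff_right hq1).1 hle

end Rank

/-! ### False positives -/

/-- A nonzero linear form `φ` and a uniformly random pair `(γ, e)`: the equation `e φ(γ) = t` has
at most `(2 / Q - 1 / Q ^ 2) Q ^ (n + 1)` solutions. -/
theorem card_mul_linearForm_eq_le {M ι : Type*} [Field M] [Fintype M] [Fintype ι]
    [DecidableEq ι] [DecidableEq M] (φ : (ι → M) →ₗ[M] M) (hφ : φ ≠ 0) (t : M) :
    ((Finset.univ.filter fun c : (ι → M) × M => c.2 * φ c.1 = t).card : ℝ) ≤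
      (2 / (Fintype.card M : ℝ) - 1 / (Fintype.card M : ℝ) ^ 2) *
        Fintype.card ((ι → M) × M) := by
  classical
  set Q := Fintype.card M with hQ
  have hQ0 : (0 : ℝ) < Q := by exact_mod_cast Fintype.card_pos
  set n := Fintype.card (ι → M) with hn
  set z := (Finset.univ.filter fun γ : ι → M => φ γ = 0).card with hz
  have hzn : z * Q = n := by
    have h := Submodule.card_eq_card_quotient_mul_card (LinearMap.ker φ)
    have hsurj : Function.Surjective φ := LinearMap.surjective hφ
    have h2 : Nat.card ((ι → M) ⧸ LinearMap.ker φ) = Q := by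
      rw [hQ, ← Nat.card_eq_fintype_card]
      exact Nat.card_congr (φ.quotKerEquivOfSurjective hsurj).toEquiv
    have h3 : Nat.card (LinearMap.ker φ) = z := by
      rw [Nat.card_eq_fintype_card, hz, Fintype.card_subtype]
      simp [LinearMap.mem_ker]
    rw [h2, h3, Nat.card_eq_fintype_card] at h
    exact h.symm
  -- If `φ γ = 0`, all `Q` values of `e` may be solutions (this happens for `t = 0`); otherwise
  -- there is at most one.
  have hcount : (Finset.univ.filter fun c : (ι → M) × M => c.2 * φ c.1 = t).card ≤
      z * Q + (n - z) := by
    have hfib : (Finset.univ.filter fun c : (ι → M) × M => c.2 * φ c.1 = t).card =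
        ∑ γ : ι → M, (Finset.univ.filter fun e : M => e * φ γ = t).card := by
      simp_rw [Finset.card_filter]
      exact Fintype.sum_prod_type _
    rw [hfib]
    have hb : ∀ γ : ι → M, (Finset.univ.filter fun e : M => e * φ γ = t).card ≤
        if φ γ = 0 then Q else 1 := by
      intro γ
      split_ifs with h0
      · exact (Finset.card_le_univ _).trans_eq hQ.symm
      · refine Finset.card_le_one.2 fun a ha b hb => ?_
        rw [Finset.mem_filter] at ha hb
        exact mul_right_cancel₀ h0 (ha.2.trans hb.2.symm)
    refine (Finset.sum_le_sum fun γ _ => hb γ).trans ?_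
    rw [Finset.sum_ite, Finset.sum_const, Finset.sum_const, smul_eq_mul, smul_eq_mul, mul_one]
    have := Finset.card_filter_add_card_filter_not (s := (Finset.univ : Finset (ι → M)))
      (fun γ => φ γ = 0)
    rw [Finset.card_univ, ← hn, ← hz] at this
    rw [← hz]
    omega
  have hzle : z ≤ n := hzn ▸ Nat.le_mul_of_pos_right z Fintype.card_pos
  have hcard : (Fintype.card ((ι → M) × M) : ℝ) = n * Q := by
    rw [Fintype.card_prod]; push_cast; rfl
  rw [hcard]
  refine (Nat.cast_le.2 hcount).trans ?_
  rw [Nat.cast_add, Nat.cast_sub hzle]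
  have hzn' : (n : ℝ) = z * Q := by exact_mod_cast hzn.symm
  rw [Nat.cast_mul, hzn']
  apply le_of_eq
  field_simp
  ring

section FalsePositive

variable {P : Params} {K L M : Type*}

theorem falsePositiveRate_eq [Field K] [Field L] [Field M] [Fintype K] [Fintype L] [Fintype M]
    [Algebra K L] [Algebra L M] : falsePositiveRate K L M =
    2 / (Fintype.card M : ℝ) - 1 / (Fintype.card M : ℝ) ^ 2 := by
  have h : Fintype.card M = Fintype.card K ^ (Module.finrank K L * Module.finrank L M) := by
    rw [Module.card_eq_pow_finrank (K := L) (V := M), Module.card_eq_pow_finrank (K := K) (V := L),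
      ← pow_mul]
  rw [falsePositiveRate, h]
  push_cast
  rw [← pow_mul, mul_comm 2]

theorem falsePositiveRate_nonneg [Field K] [Field L] [Field M] [Fintype K] [Fintype L]
    [Fintype M] [Algebra K L] [Algebra L M] : 0 ≤ falsePositiveRate K L M := by
  rw [falsePositiveRate_eq]
  have h : (1 : ℝ) ≤ Fintype.card M := by exact_mod_cast Fintype.card_pos
  rw [sub_nonneg, div_le_div_iff₀ (by positivity) (by positivity)]
  nlinarith

/-- The map `x_B ↦ (y - H' x_B ‖ x_B)` is only affine. It becomes linear in the pair `(1, x_B)`, and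
the public shares of `1` supply the first component. -/
theorem reconstructVec_fullVec [Field K] [Field L] [Algebra K L]
    (D : PublicData P K L M) {J : Finset (Fin P.N)}
    (hJ : J.card = P.ℓ + 1) (xB : Fin P.N → Fin P.k → L) :
    (D.lsss.reconstructVec J fun i => fullVec D (D.one i) (xB i)) =
      fullVec D (1 : K) (D.lsss.reconstructVec J xB) := by
  have hone := D.one_isSharing J hJ
  rw [ThresholdLSSS.reconstructVec_eq_sum] at hone
  let ψ : (Fin P.k → L) →ₗ[K] (Fin (P.n - P.k) → L) := (D.H'.mulVecLin).restrictScalars K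
  have hψ := D.lsss.reconstructVec_map ψ J xB
  ext i
  rw [ThresholdLSSS.reconstructVec_apply]
  cases i with
  | inl i =>
    simp only [fullVec, Sum.elim_inl, Pi.sub_apply, Pi.smul_apply, one_smul]
    rw [ThresholdLSSS.reconstructVec_sub]
    congr 1
    · rw [ThresholdLSSS.reconstructVec_eq_sum]
      simp_rw [smul_smul, ← smul_eq_mul (a := D.lsss.coeff J _)]
      rw [← Finset.sum_smul, hone, one_smul]
    · have := congrFun hψ i
      rw [ThresholdLSSS.reconstructVec_apply] at this
      exact this
  | inr i =>
    simp only [fullVec, Sum.elim_inr]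
    rw [ThresholdLSSS.reconstructVec_apply]

variable [Field K] [Field L] [Field M]
  [Fintype K] [Algebra K L] [Algebra L M] [Algebra K M]

/-- The `K`-linear map `x ↦ ∑ j, γ j * (x j ^ q ^ s - x j)`. -/
def frobComb [IsScalarTower K L M] {ι : Type*} [Fintype ι] (γ : ι → M) (s : ℕ) :
    (ι → L) →ₗ[K] M :=
  ∑ j, (LinearMap.mulLeft K (γ j)).comp
    (((IsScalarTower.toAlgHom K L M).toLinearMap.comp (frobSub K s)).comp (LinearMap.proj j))

theorem frobComb_apply [IsScalarTower K L M] {ι : Type*} [Fintype ι] (γ : ι → M) (s : ℕ)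
    (x : ι → L) : frobComb (K := K) γ s x =
      ∑ j, γ j * algebraMap L M (x j ^ Fintype.card K ^ s - x j) := by
  simp [frobComb, LinearMap.sum_apply]

/-- The state reconstructed from the shares of the parties of `J`. -/
def reconstructState (D : PublicData P K L M) (J : Finset (Fin P.N))
    (st : Fin P.N → State P L M) : State P L M where
  xB := D.lsss.reconstructVec J fun i => (st i).xB
  β := D.lsss.reconstructVec J fun i => (st i).β
  a := D.lsss.reconstructVec J fun i => (st i).a
  c := D.lsss.reconstructVec J fun i => (st i).c

/-- The multi-party computation on the secret state `m` succeeds. -/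
def MpcAccepts [IsScalarTower K L M] (D : PublicData P K L M) (m : State P L M)
    (ch : Challenge₁ P M) : Prop :=
  let x := fullVec D (1 : K) m.xB
  ch.2 * (-frobComb (K := K) ch.1 P.r x) -
    ∑ e, (ch.2 * frobComb (K := K) ch.1 (e.1 + 1) x + m.a e) * algebraMap L M (m.β e) - m.c = 0

/-- Once the opened value `α₀` is treated as a constant, the local computations are `K`-linear in
the shared data: Frobenius powers are `K`-linear, and the product of `α` and `β` becomes linear in
`β`. Reconstruction therefore commutes with them. -/
theorem mpcAccepts_reconstructState [IsScalarTower K L M] (D : PublicData P K L M)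
    {J : Finset (Fin P.N)} (hJ : J.card = P.ℓ + 1) (st : Fin P.N → State P L M)
    (ch : Challenge₁ P M) {α₀ : Fin (P.r - 1) → M} {α : Fin P.N → Fin (P.r - 1) → M}
    {v : Fin P.N → M} (hα : D.lsss.IsSharingOf α α₀) (hv : D.lsss.IsSharingOf v 0)
    (hα' : ∀ i ∈ J, α i = partyα D ch i (st i)) (hv' : ∀ i ∈ J, v i = partyV D ch α₀ i (st i)) :
    MpcAccepts D (reconstructState D J st) ch := by
  set σ := D.lsss
  have hx := reconstructVec_fullVec D hJ fun i => (st i).xB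
  have hfrob : ∀ s, (σ.reconstructVec J fun i =>
      frobComb (K := K) ch.1 s (fullVec D (D.one i) (st i).xB)) =
      frobComb (K := K) ch.1 s (fullVec D (1 : K) (reconstructState D J st).xB) := fun s => by
    rw [σ.reconstructVec_map, hx]; rfl
  have e₁ : ∀ e, α₀ e = ch.2 * frobComb (K := K) ch.1 (e.1 + 1)
      (fullVec D (1 : K) (reconstructState D J st).xB) + (reconstructState D J st).a e := by
    intro e
    rw [← hα J hJ, ThresholdLSSS.reconstructVec_congr _ hα', ThresholdLSSS.reconstructVec_apply,
      ← hfrob, ← LinearMap.mulLeft_apply (R := K), ← σ.reconstructVec_map]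
    simp only [reconstructState, ThresholdLSSS.reconstructVec_apply]
    rw [← ThresholdLSSS.reconstructVec_add]
    simp [partyα, partyω, frobComb_apply]
  have e₂ := hv J hJ
  rw [ThresholdLSSS.reconstructVec_congr _ hv'] at e₂
  let ψ : (Fin (P.r - 1) → L) →ₗ[K] M := ∑ e, (LinearMap.mulLeft K (α₀ e)).comp
    ((IsScalarTower.toAlgHom K L M).toLinearMap.comp (LinearMap.proj e))
  have hψ : ∀ b, ψ b = ∑ e, α₀ e * algebraMap L M (b e) := fun b => by
    simp [ψ, LinearMap.sum_apply]
  rw [MpcAccepts, ← e₂]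
  simp only [← e₁]
  rw [← hψ, ← hfrob, mul_neg, ← LinearMap.mulLeft_apply (R := K), ← LinearMap.neg_apply,
    ← σ.reconstructVec_map]
  simp only [reconstructState]
  rw [← σ.reconstructVec_map ψ, ← ThresholdLSSS.reconstructVec_sub,
    ← ThresholdLSSS.reconstructVec_sub]
  simp only [partyV, partyZ, frobComb_apply, hψ, LinearMap.neg_apply, LinearMap.mulLeft_apply,
    mul_neg]

-- Collecting the terms with `e` turns acceptance into `e φ(γ) = t`, where the coefficients of `φ`
-- are the values of the linearized polynomial at the coordinates of `x` and `t` depends only on the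
-- state. If `φ` were zero, `x` would have rank weight at most `r`.
open Classical in
theorem card_mpcAccepts_le [Fintype L] [Fintype M] [IsScalarTower K L M]
    (D : PublicData P K L M) (m : State P L M)
    (hm : ¬ rankWeight K (fullVec D (1 : K) m.xB) ≤ P.r) :
    ((Finset.univ.filter fun ch : Challenge₁ P M => MpcAccepts D m ch).card : ℝ) ≤
      falsePositiveRate K L M * Fintype.card (Challenge₁ P M) := by
  set x := fullVec D (1 : K) m.xB with hx
  let y : Pos P → L := fun j => frobSub K P.r (x j) + ∑ e, m.β e * frobSub K (e.1 + 1) (x j)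
  let φ : (Pos P → M) →ₗ[M] M := ∑ j, (LinearMap.mulRight M (algebraMap L M (y j))).comp
    (LinearMap.proj j)
  have hφ : ∀ γ, φ γ = ∑ j, γ j * algebraMap L M (y j) := fun γ => by
    simp [φ, LinearMap.sum_apply]
  have hφ0 : φ ≠ 0 := by
    intro h0
    refine hm (rankWeight_le_of_linearized_eq_zero K P.r_pos m.β x fun j => ?_)
    have := congrArg (fun f => f (Pi.single j (1 : M))) h0
    simp only [hφ, LinearMap.zero_apply, Pi.single_apply, ite_mul, one_mul, zero_mul,
      Finset.sum_ite_eq', Finset.mem_univ, if_true] at this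
    exact (map_eq_zero _).1 this
  have key : ∀ ch : Challenge₁ P M, MpcAccepts D m ch ↔
      ch.2 * φ ch.1 = -(∑ e, m.a e * algebraMap L M (m.β e) + m.c) := by
    intro ch
    have hexp : φ ch.1 = frobComb (K := K) ch.1 P.r x +
        ∑ e, frobComb (K := K) ch.1 (e.1 + 1) x * algebraMap L M (m.β e) := by
      simp only [hφ, y, frobComb_apply, frobSub_apply, map_add, map_sum, map_mul, mul_add,
        Finset.sum_add_distrib, Finset.mul_sum, Finset.sum_mul]
      congr 1
      rw [Finset.sum_comm]
      exact Finset.sum_congr rfl fun e _ => Finset.sum_congr rfl fun j _ => by ring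
    rw [hexp, MpcAccepts, ← hx]
    simp only [add_mul, Finset.sum_add_distrib, mul_add, Finset.mul_sum, mul_assoc]
    constructor
    · intro h; linear_combination -h
    · intro h; linear_combination -h
  rw [falsePositiveRate_eq, Finset.filter_congr fun ch _ => key ch]
  convert card_mul_linearForm_eq_le φ hφ0 _

end FalsePositive

/-! ### Merkle trees -/

/-- Two computations of the same Merkle root with different values at some leaf contain a
collision. -/
theorem exists_collision_of_rebuild_eq {d : ℕ} (hashM : List Bool → List.Vector Bool d)
    (leaf leaf' : ℕ → Option (List Bool)) (auth auth' : ℕ → ℕ → List.Vector Bool d)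
    {i : ℕ} {v v' : List Bool} (hv : leaf i = some v) (hv' : leaf' i = some v') (hne : v ≠ v')
    (len : ℕ) : ∀ lo, lo ≤ i → i < lo + len →
      rebuild hashM leaf auth lo len = rebuild hashM leaf' auth' lo len →
      ∃ u ∈ rebuildInputs hashM leaf auth lo len, ∃ u' ∈ rebuildInputs hashM leaf' auth' lo len,
        u ≠ u' ∧ hashM u = hashM u' := by
  induction len using Nat.strong_induction_on with
  | _ len ih =>
    intro lo hlo hhi heq
    have hk : ¬ ∀ j, lo ≤ j → j < lo + len → leaf j = none := fun h => by
      simpa [hv] using h i hlo hhi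
    have hk' : ¬ ∀ j, lo ≤ j → j < lo + len → leaf' j = none := fun h => by
      simpa [hv'] using h i hlo hhi
    rw [rebuild.eq_def _ leaf _ lo len, rebuild.eq_def _ leaf' _ lo len, if_neg hk,
      if_neg hk'] at heq
    rw [rebuildInputs.eq_def _ leaf _ lo len, rebuildInputs.eq_def _ leaf' _ lo len, if_neg hk,
      if_neg hk']
    by_cases hlen : len ≤ 1
    · obtain rfl : i = lo := by omega
      rw [if_pos hlen, if_pos hlen, hv, hv'] at heq
      rw [if_pos hlen, if_pos hlen, hv, hv']
      exact ⟨v, rfl, v', rfl, hne, heq⟩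
    · rw [if_neg hlen, if_neg hlen] at heq
      rw [if_neg hlen, if_neg hlen]
      by_cases hcat : (rebuild hashM leaf auth lo (len / 2)).toList ++
          (rebuild hashM leaf auth (lo + len / 2) (len - len / 2)).toList =
          (rebuild hashM leaf' auth' lo (len / 2)).toList ++
          (rebuild hashM leaf' auth' (lo + len / 2) (len - len / 2)).toList
      -- Digests have fixed length, so equal concatenations have equal halves; descend into the half
      -- containing leaf `i`.
      · obtain ⟨h₁, h₂⟩ := List.append_inj hcat (by simp)
        by_cases hi : i < lo + len / 2
        · obtain ⟨u, hu, u', hu', h⟩ := ih (len / 2) (by omega) lo hlo hi (List.Vector.eq _ _ h₁)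
          exact ⟨u, Or.inr (Or.inl hu), u', Or.inr (Or.inl hu'), h⟩
        · obtain ⟨u, hu, u', hu', h⟩ := ih (len - len / 2) (by omega) (lo + len / 2) (by omega)
            (by omega) (List.Vector.eq _ _ h₂)
          exact ⟨u, Or.inr (Or.inr hu), u', Or.inr (Or.inr hu'), h⟩
      · exact ⟨_, Or.inl rfl, _, Or.inl rfl, hcat, heq⟩

/-- `binom(g, ℓ) ≤ 1 + ℓ binom(g, ℓ + 1)`. -/
theorem choose_le_one_add_mul_choose_succ (g ℓ : ℕ) :
    g.choose ℓ ≤ 1 + ℓ * g.choose (ℓ + 1) := by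
  induction g with
  | zero => cases ℓ <;> simp
  | succ g ih =>
    cases ℓ with
    | zero => simp
    | succ ℓ =>
      rcases lt_or_ge g (ℓ + 1) with h | h
      · have : (g + 1).choose (ℓ + 1) ≤ 1 := by
          rcases Nat.lt_or_ge g ℓ with h' | h'
          · rw [Nat.choose_eq_zero_of_lt (by omega)]; omega
          · obtain rfl : g = ℓ := by omega
            simp
        omega
      · have h1 : g.choose ℓ ≤ (ℓ + 1) * g.choose (ℓ + 1) := by
          have := Nat.choose_succ_right_eq g ℓ
          calc g.choose ℓ ≤ g.choose ℓ * (g - ℓ) := Nat.le_mul_of_pos_right _ (by omega)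
            _ = (ℓ + 1) * g.choose (ℓ + 1) := by rw [← this, mul_comm]
        rw [Nat.choose_succ_succ g ℓ, Nat.choose_succ_succ g (ℓ + 1)]
        nlinarith

/-! ### What a list of calls reveals -/

section Knowledge

variable {P : Params} {K L M : Type*}

/-- The state `m` of party `i` was opened in session `s`. -/
def Opened (κ : Set (ℕ × Transcript P L M)) (s : ℕ) (i : Fin P.N) (m : State P L M) : Prop :=
  ∃ T, (s, T) ∈ κ ∧ ∃ hi : i ∈ T.ch₂.1, (T.rsp₂.opening ⟨i, hi⟩).1 = m

open Classical in
/-- The parties opened in session `s`. -/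
def openedParties (κ : Set (ℕ × Transcript P L M)) (s : ℕ) : Finset (Fin P.N) :=
  Finset.univ.filter fun i => ∃ m, Opened κ s i m

theorem Opened.insert {κ : Set (ℕ × Transcript P L M)} {s : ℕ} {i : Fin P.N} {m : State P L M}
    (h : Opened κ s i m) (p : ℕ × Transcript P L M) : Opened (insert p κ) s i m := by
  obtain ⟨T, hT, h⟩ := h
  exact ⟨T, Or.inr hT, h⟩

theorem mem_openedParties {κ : Set (ℕ × Transcript P L M)} {s : ℕ} {i : Fin P.N} :
    i ∈ openedParties κ s ↔ ∃ m, Opened κ s i m := by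
  simp [openedParties]

theorem openedParties_subset_insert (κ : Set (ℕ × Transcript P L M)) (s : ℕ)
    (p : ℕ × Transcript P L M) : openedParties κ s ⊆ openedParties (insert p κ) s := by
  intro i hi
  rw [mem_openedParties] at hi ⊢
  exact hi.imp fun m hm => hm.insert p

theorem Transcript.leaf_eq [Field K] (D : PublicData P K L M) (T : Transcript P L M) {i : Fin P.N}
    (hi : i ∈ T.ch₂.1) : T.leaf D i.1 =
      some (D.com (T.rsp₂.opening ⟨i, hi⟩).1 (T.rsp₂.opening ⟨i, hi⟩).2) := by
  rw [Transcript.leaf, dif_pos ⟨i.2, hi⟩]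

variable [Field K] [Field L] [Field M]
  [Fintype K] [Algebra K L] [Algebra L M] [Algebra K M]

/-- The accepted transcripts of a list of calls, with the numbers of their sessions. -/
def knowledge (D : PublicData P K L M) (h : List (Call P L M)) : Set (ℕ × Transcript P L M) :=
  {p | p.2.Accepted D ∧ ∃ C ∈ h, C.session = p.1 ∧ C.T = p.2}

theorem knowledge_append_of_accepted (D : PublicData P K L M) (h : List (Call P L M))
    {C : Call P L M} (hC : C.T.Accepted D) :
    knowledge D (h ++ [C]) = insert (C.session, C.T) (knowledge D h) := by
  ext ⟨s, T⟩
  simp only [knowledge, List.mem_append, List.mem_singleton, Set.mem_ofPred_eq, Set.mem_insert_iff,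
    Prod.mk.injEq]
  constructor
  · rintro ⟨ha, C', h' | rfl, rfl, rfl⟩
    · exact Or.inr ⟨ha, C', h', rfl, rfl⟩
    · exact Or.inl ⟨rfl, rfl⟩
  · rintro (⟨rfl, rfl⟩ | ⟨ha, C', h', e⟩)
    · exact ⟨hC, C, Or.inr rfl, rfl, rfl⟩
    · exact ⟨ha, C', Or.inl h', e⟩

theorem knowledge_append_of_not_accepted (D : PublicData P K L M) (h : List (Call P L M))
    {C : Call P L M} (hC : ¬ C.T.Accepted D) : knowledge D (h ++ [C]) = knowledge D h := by
  ext ⟨s, T⟩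
  simp only [knowledge, List.mem_append, List.mem_singleton, Set.mem_ofPred_eq]
  constructor
  · rintro ⟨ha, C', h' | rfl, rfl, rfl⟩
    · exact ⟨ha, C', h', rfl, rfl⟩
    · exact absurd ha hC
  · rintro ⟨ha, C', h', e⟩
    exact ⟨ha, C', Or.inl h', e⟩

/-- The output is read off from the accepted transcripts `κ`. -/
def Output.ReadFrom (D : PublicData P K L M) (κ : Set (ℕ × Transcript P L M)) :
    Output P L M → Prop
  | .comCollision m m' ρ ρ' => ∀ o ∈ [(m, ρ), (m', ρ')], ∃ p ∈ κ, ∃ i, p.2.rsp₂.opening i = o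
  | .merkleCollision u u' => ∀ w ∈ [u, u'], ∃ p ∈ κ,
      w ∈ rebuildInputs D.hashM (p.2.leaf D) p.2.rsp₂.auth 0 P.N
  | .hashCollision b b' => ∀ w ∈ [b, b'], ∃ p ∈ κ, p.2.HashInput D w
  | .witness x => ∃ (s : ℕ) (J : Finset (Fin P.N)) (st : Fin P.N → State P L M),
      J.card = P.ℓ + 1 ∧ (∀ i ∈ J, Opened κ s i (st i)) ∧
      x = fullVec D 1 (D.lsss.reconstructVec J fun i => (st i).xB)

theorem Output.ReadFrom.readOff {D : PublicData P K L M} {h : List (Call P L M)}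
    {o : Output P L M} (ho : o.ReadFrom D (knowledge D h)) : o.ReadOff D h := by
  cases o with
  | comCollision m m' ρ ρ' =>
    intro o ho'
    obtain ⟨_, ⟨ha, C, hC, -, e⟩, hp⟩ := ho o ho'
    exact ⟨C, hC, e ▸ ha, e ▸ hp⟩
  | merkleCollision u u' =>
    intro o ho'
    obtain ⟨_, ⟨ha, C, hC, -, e⟩, hp⟩ := ho o ho'
    exact ⟨C, hC, e ▸ ha, e ▸ hp⟩
  | hashCollision b b' =>
    intro o ho'
    obtain ⟨_, ⟨ha, C, hC, -, e⟩, hp⟩ := ho o ho'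
    exact ⟨C, hC, e ▸ ha, e ▸ hp⟩
  | witness x =>
    obtain ⟨s, J, st, hJ, hop, hx⟩ := ho
    refine ⟨s, J, st, hJ, fun i hi => ?_, hx⟩
    obtain ⟨T, ⟨ha, C, hC, hs, rfl⟩, hT⟩ := hop i hi
    exact ⟨C, hC, hs, ha, hT⟩

/-- A valid output can be read off from the accepted transcripts `κ`. -/
def Found [Fintype L] (D : PublicData P K L M) (κ : Set (ℕ × Transcript P L M)) : Prop :=
  ∃ o : Output P L M, o.Valid D ∧ o.ReadFrom D κ

/-- All transcripts of `κ` are accepted, and those of one session have the same commitment. -/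
structure Coherent (D : PublicData P K L M) (κ : Set (ℕ × Transcript P L M)) : Prop where
  accepted : ∀ p ∈ κ, p.2.Accepted D
  root_eq : ∀ p ∈ κ, ∀ p' ∈ κ, p.1 = p'.1 → p.2.h₀ = p'.2.h₀

/-- The accepted transcript `T` of session `s` gives an output or opens a new party. -/
def Progress [Fintype L] (D : PublicData P K L M) (κ : Set (ℕ × Transcript P L M)) (s : ℕ)
    (T : Transcript P L M) : Prop :=
  Found D (insert (s, T) κ) ∨
    (openedParties κ s).card < (openedParties (insert (s, T) κ) s).card

/-- Without a collision, a party has only one state in a session. -/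
theorem Opened.unique [Fintype L] {D : PublicData P K L M} {κ : Set (ℕ × Transcript P L M)}
    (hκ : Coherent D κ) (hf : ¬ Found D κ) {s : ℕ} {i : Fin P.N} {m m' : State P L M}
    (h : Opened κ s i m) (h' : Opened κ s i m') : m = m' := by
  by_contra hne
  obtain ⟨T, hT, hi, rfl⟩ := h
  obtain ⟨T', hT', hi', rfl⟩ := h'
  -- Equal commitments to different states are a commitment collision; different commitments at leaf
  -- `i` under one root contain a Merkle collision.
  by_cases hcom : D.com (T.rsp₂.opening ⟨i, hi⟩).1 (T.rsp₂.opening ⟨i, hi⟩).2 =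
      D.com (T'.rsp₂.opening ⟨i, hi'⟩).1 (T'.rsp₂.opening ⟨i, hi'⟩).2
  · refine hf ⟨.comCollision _ _ _ _, ⟨hne, hcom⟩, ?_⟩
    simp only [Output.ReadFrom, List.mem_cons, List.not_mem_nil, or_false]
    rintro o (rfl | rfl)
    · exact ⟨_, hT, ⟨i, hi⟩, rfl⟩
    · exact ⟨_, hT', ⟨i, hi'⟩, rfl⟩
  · have hroot : rebuild D.hashM (T.leaf D) T.rsp₂.auth 0 P.N =
        rebuild D.hashM (T'.leaf D) T'.rsp₂.auth 0 P.N :=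
      (hκ.accepted _ hT).1.trans ((hκ.root_eq _ hT _ hT' rfl).trans (hκ.accepted _ hT').1.symm)
    obtain ⟨u, hu, u', hu', hv⟩ := exists_collision_of_rebuild_eq D.hashM _ _ _ _
      (T.leaf_eq D hi) (T'.leaf_eq D hi') hcom P.N 0 (Nat.zero_le _) (by simp) hroot
    refine hf ⟨.merkleCollision u u', hv, ?_⟩
    simp only [Output.ReadFrom, List.mem_cons, List.not_mem_nil, or_false]
    rintro o (rfl | rfl)
    exacts [⟨_, hT, hu⟩, ⟨_, hT', hu'⟩]

/-- Without an output, the states opened in a session do not contain a solution. -/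
theorem not_rankWeight_le_of_not_found [Fintype L] {D : PublicData P K L M}
    {κ : Set (ℕ × Transcript P L M)} (hf : ¬ Found D κ) {s : ℕ} {J : Finset (Fin P.N)}
    (hJ : J.card = P.ℓ + 1) {st : Fin P.N → State P L M} (hst : ∀ i ∈ J, Opened κ s i (st i)) :
    ¬ rankWeight K (fullVec D (1 : K) (reconstructState D J st).xB) ≤ P.r := by
  intro hr
  refine hf ⟨.witness _, ⟨?_, hr⟩, s, J, st, hJ, hst, rfl⟩
  -- The syndrome equation holds for every `x_B`; only the rank condition is at stake.
  simp [fullVec, Matrix.fromCols_mulVec]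

theorem Coherent.insert {D : PublicData P K L M} {κ : Set (ℕ × Transcript P L M)}
    (hκ : Coherent D κ) {s : ℕ} {T T₀ : Transcript P L M} (hT₀ : (s, T₀) ∈ κ)
    (hT : T.Accepted D) (h : T.h₀ = T₀.h₀) : Coherent D (insert (s, T) κ) where
  accepted := by
    rintro p (rfl | hp)
    · exact hT
    · exact hκ.accepted p hp
  root_eq := by
    rintro p (rfl | hp) p' (rfl | hp') hs
    · rfl
    · exact h.trans (hκ.root_eq _ hT₀ _ hp' hs)
    · exact (hκ.root_eq _ hp _ hT₀ hs).trans h.symm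
    · exact hκ.root_eq _ hp _ hp' hs

open Classical in
/-- The sets of `ℓ + 1` opened parties whose states pass the multi-party computation. -/
def falsePositives [IsScalarTower K L M] (D : PublicData P K L M)
    (κ : Set (ℕ × Transcript P L M)) (s : ℕ) (st : Fin P.N → State P L M)
    (ch : Challenge₁ P M) : Finset (Finset (Fin P.N)) :=
  ((openedParties κ s).powersetCard (P.ℓ + 1)).filter
    fun J => MpcAccepts D (reconstructState D J st) ch

/-- Two accepted transcripts with the same first three messages and no hash collision recover the
same sharings. -/
theorem recovers_eq_of_not_found [Fintype L] {D : PublicData P K L M}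
    {κ : Set (ℕ × Transcript P L M)} (hf : ¬ Found D κ) {s s' : ℕ} {T T' : Transcript P L M}
    (hT : (s, T) ∈ κ) (hT' : (s', T') ∈ κ) (hrsp : T'.rsp₁ = T.rsp₁)
    {α₀ α₀' : Fin (P.r - 1) → M} {α α' : Fin P.N → Fin (P.r - 1) → M} {v v' : Fin P.N → M}
    (hr : T.Recovers D α₀ α v) (hr' : T'.Recovers D α₀' α' v')
    (hh : D.hash (fun j => (α (T.rsp₁.S.1.orderEmbOfFin T.rsp₁.S.2 j),
      v (T.rsp₁.S.1.orderEmbOfFin T.rsp₁.S.2 j))) =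
      D.hash (fun j => (α' (T.rsp₁.S.1.orderEmbOfFin T.rsp₁.S.2 j),
      v' (T.rsp₁.S.1.orderEmbOfFin T.rsp₁.S.2 j)))) :
    α₀ = α₀' ∧ α = α' ∧ v = v' := by
  have hb : (fun j => (α (T.rsp₁.S.1.orderEmbOfFin T.rsp₁.S.2 j),
      v (T.rsp₁.S.1.orderEmbOfFin T.rsp₁.S.2 j))) =
      (fun j => (α' (T.rsp₁.S.1.orderEmbOfFin T.rsp₁.S.2 j),
      v' (T.rsp₁.S.1.orderEmbOfFin T.rsp₁.S.2 j))) := by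
    by_contra hne
    refine hf ⟨.hashCollision _ _, ⟨hne, hh⟩, ?_⟩
    simp only [Output.ReadFrom, List.mem_cons, List.not_mem_nil, or_false]
    rintro o (rfl | rfl)
    · exact ⟨_, hT, α₀, α, v, hr, rfl⟩
    · exact ⟨_, hT', α₀', α', v', hr', by simp only [hrsp]⟩
  have hS : ∀ i ∈ T.rsp₁.S.1, α i = α' i ∧ v i = v' i := by
    intro i hi
    obtain ⟨j, rfl⟩ : i ∈ Set.range (T.rsp₁.S.1.orderEmbOfFin T.rsp₁.S.2) := by
      rw [Finset.range_orderEmbOfFin]; exact hi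
    simpa using congrFun hb j
  -- The hash fixes the shares of the `ℓ + 1` parties of `S`, and these fix the whole sharing.
  obtain ⟨h₁, h₂⟩ := hr.1.eq_of_eqOn hr'.1 T.rsp₁.S.2 fun i hi => (hS i hi).1
  obtain ⟨-, h₃⟩ := hr.2.1.eq_of_eqOn hr'.2.1 T.rsp₁.S.2 fun i hi => (hS i hi).2
  exact ⟨h₁, h₂, h₃⟩

/-- After an accepted call with first challenge `ch`, only few second challenges are accepted
without progress. -/
theorem card_not_progress_le [Fintype L] [IsScalarTower K L M] {D : PublicData P K L M}
    {κ : Set (ℕ × Transcript P L M)} (hκ : Coherent D κ) {s : ℕ} {T₀ : Transcript P L M}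
    (hT₀ : (s, T₀) ∈ κ) {st : Fin P.N → State P L M}
    (hst : ∀ i m, Opened κ s i m → m = st i) (T : Challenge₂ P → Transcript P L M)
    (hch₂ : ∀ I, (T I).ch₂ = I) (hroot : ∀ I, (T I).h₀ = T₀.h₀)
    (hch₁ : ∀ I, (T I).ch₁ = T₀.ch₁) (hrsp : ∀ I, (T I).rsp₁ = T₀.rsp₁)
    (𝓘 : Finset (Challenge₂ P)) (h𝓘 : ∀ I ∈ 𝓘, (T I).Accepted D ∧ ¬ Progress D κ s (T I)) :
    𝓘.card ≤ 1 + P.ℓ * (falsePositives D κ s st T₀.ch₁).card := by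
  classical
  obtain ⟨-, -, -, b, ⟨α₀, α, v, hr, rfl⟩, hb⟩ := hκ.accepted _ hT₀
  -- The sharings `α`, `v` come from the single transcript `T₀`; every accepted `I` without progress
  -- is shown to recover the same ones and to lie in `G`.
  let G := (openedParties κ s).filter fun i =>
    α i = partyα D T₀.ch₁ i (st i) ∧ v i = partyV D T₀.ch₁ α₀ i (st i)
  have hG : ∀ I ∈ 𝓘, I.1 ⊆ G := by
    intro I hI i hiI
    obtain ⟨hacc, hnp⟩ := h𝓘 I hI
    rw [Progress, not_or, not_lt] at hnp
    obtain ⟨hnf, hcard⟩ := hnp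
    have hκ' := hκ.insert hT₀ hacc (hroot I)
    -- Without progress the parties of `I` were opened before, so their states are those recorded by
    -- `st`.
    have heq : openedParties κ s = openedParties (insert (s, T I) κ) s :=
      Finset.eq_of_subset_of_card_le (openedParties_subset_insert _ _ _) hcard
    obtain ⟨-, -, -, b', ⟨α₀', α', v', hr', rfl⟩, hb'⟩ := hacc
    simp only [hrsp I] at hb'
    obtain ⟨rfl, rfl, rfl⟩ := recovers_eq_of_not_found hnf (s := s) (s' := s) (T := T₀)
      (T' := T I) (Or.inr hT₀) (Or.inl rfl) (hrsp I) hr hr' (hb.trans hb'.symm)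
    have hi : i ∈ (T I).ch₂.1 := by rw [hch₂]; exact hiI
    have hop : Opened (insert (s, T I) κ) s i ((T I).rsp₂.opening ⟨i, hi⟩).1 :=
      ⟨T I, Or.inl rfl, hi, rfl⟩
    have hiR : i ∈ openedParties κ s := by
      rw [heq, mem_openedParties]
      exact ⟨_, hop⟩
    obtain ⟨m, hm⟩ := mem_openedParties.1 hiR
    have hm' : ((T I).rsp₂.opening ⟨i, hi⟩).1 = st i :=
      (hop.unique hκ' hnf (hm.insert _)).trans (hst i m hm)
    refine Finset.mem_filter.2 ⟨hiR, ?_, ?_⟩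
    · rw [hr'.2.2.1 ⟨i, hi⟩, hm', hch₁]
    · rw [hr'.2.2.2.2 ⟨i, hi⟩, hm', hch₁]
  calc 𝓘.card = (𝓘.image Subtype.val).card :=
        (Finset.card_image_of_injective _ Subtype.val_injective).symm
    _ ≤ (G.powersetCard P.ℓ).card := by
        refine Finset.card_le_card fun I hI => ?_
        obtain ⟨I, hI', rfl⟩ := Finset.mem_image.1 hI
        exact Finset.mem_powersetCard.2 ⟨hG I hI', I.2⟩
    _ ≤ 1 + P.ℓ * (G.powersetCard (P.ℓ + 1)).card := by
        rw [Finset.card_powersetCard, Finset.card_powersetCard]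
        exact choose_le_one_add_mul_choose_succ _ _
    _ ≤ 1 + P.ℓ * (falsePositives D κ s st T₀.ch₁).card := by
        gcongr
        intro J hJ
        obtain ⟨hJG, hJ⟩ := Finset.mem_powersetCard.1 hJ
        refine Finset.mem_filter.2 ⟨Finset.mem_powersetCard.2
          ⟨hJG.trans (Finset.filter_subset _ _), hJ⟩, ?_⟩
        exact mpcAccepts_reconstructState D hJ st T₀.ch₁ hr.1 hr.2.1
          (fun i hi => (Finset.mem_filter.1 (hJG hi)).2.1)
          (fun i hi => (Finset.mem_filter.1 (hJG hi)).2.2)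

/-- By `(ℓ + 1) binom(N, ℓ + 1) = (N - ℓ) binom(N, ℓ)`, the soundness error is the bound `1 + ℓ p
binom(N, ℓ + 1)` for the mean number of useless challenges, divided by the number of challenges. -/
theorem choose_mul_soundnessError (P : Params) (p : ℝ) :
    (P.N.choose P.ℓ : ℝ) * soundnessError P.N P.ℓ p =
      1 + P.ℓ * (p * P.N.choose (P.ℓ + 1)) := by
  have h := Nat.choose_succ_right_eq P.N P.ℓ
  have hmul : (P.N.choose (P.ℓ + 1) : ℝ) * (P.ℓ + 1) = P.N.choose P.ℓ * ((P.N : ℝ) - P.ℓ) := by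
    rw [← Nat.cast_sub P.ℓ_lt_N.le]
    exact_mod_cast h
  have hC : (P.N.choose P.ℓ : ℝ) ≠ 0 := by
    exact_mod_cast (Nat.choose_pos P.ℓ_lt_N.le).ne'
  have hl : (P.ℓ : ℝ) + 1 ≠ 0 := by positivity
  rw [soundnessError]
  field_simp
  linear_combination (-(p * P.ℓ)) * hmul

/-- On average over the first challenge, the bound of `card_not_progress_le` is at most the
soundness error. -/
theorem sum_falsePositives_le [Fintype L] [Fintype M] [IsScalarTower K L M]
    {D : PublicData P K L M} {κ : Set (ℕ × Transcript P L M)} (hf : ¬ Found D κ) {s : ℕ}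
    {st : Fin P.N → State P L M} (hst : ∀ i ∈ openedParties κ s, Opened κ s i (st i)) :
    ∑ ch : Challenge₁ P M, (1 + (P.ℓ : ℝ) * (falsePositives D κ s st ch).card) ≤
      Fintype.card (Challenge₁ P M) *
        (P.N.choose P.ℓ * soundnessError P.N P.ℓ (falsePositiveRate K L M)) := by
  classical
  set p := falsePositiveRate K L M with hp
  have hp0 : 0 ≤ p := falsePositiveRate_nonneg
  -- Count pairs of a challenge and a set `J` the other way round. This is possible because `κ` and
  -- `st` do not depend on the challenge.
  have hswap : ∑ ch : Challenge₁ P M, ((falsePositives D κ s st ch).card : ℝ) =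
      ∑ J ∈ (openedParties κ s).powersetCard (P.ℓ + 1), ((Finset.univ.filter
        fun ch : Challenge₁ P M => MpcAccepts D (reconstructState D J st) ch).card : ℝ) := by
    simp only [falsePositives, Finset.card_filter, Nat.cast_sum]
    rw [Finset.sum_comm]
  have hbound : ∑ ch : Challenge₁ P M, ((falsePositives D κ s st ch).card : ℝ) ≤
      P.N.choose (P.ℓ + 1) * (p * Fintype.card (Challenge₁ P M)) := by
    rw [hswap]
    refine (Finset.sum_le_card_nsmul _ _ (p * Fintype.card (Challenge₁ P M)) fun J hJ => ?_).trans
      ?_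
    · obtain ⟨hJR, hJ⟩ := Finset.mem_powersetCard.1 hJ
      exact card_mpcAccepts_le D _
        (not_rankWeight_le_of_not_found hf hJ fun i hi => hst i (hJR hi))
    · rw [nsmul_eq_mul, Finset.card_powersetCard]
      gcongr
      exact (Finset.card_le_univ _).trans_eq (by simp)
  rw [choose_mul_soundnessError, Finset.sum_add_distrib, ← Finset.mul_sum, Finset.sum_const,
    Finset.card_univ, nsmul_eq_mul, mul_one, mul_add, mul_one]
  have := mul_le_mul_of_nonneg_left hbound (Nat.cast_nonneg (α := ℝ) P.ℓ)
  linarith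

end Knowledge

/-! ### Expectations of discrete distributions -/

section Mean

variable {α β : Type*}

/-- The expectation of `f` under `p`. -/
def mean (p : PMF α) (f : α → ℝ≥0∞) : ℝ≥0∞ := ∑' a, p a * f a

theorem mean_pure (a : α) (f : α → ℝ≥0∞) : mean (PMF.pure a) f = f a := by
  rw [mean, tsum_eq_single a fun b hb => by rw [PMF.pure_apply_of_ne _ _ hb, zero_mul],
    PMF.pure_apply_self, one_mul]

theorem mean_bind (p : PMF α) (q : α → PMF β) (f : β → ℝ≥0∞) :
    mean (p.bind q) f = mean p fun a => mean (q a) f := by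
  simp only [mean, PMF.bind_apply, ← ENNReal.tsum_mul_left, ← ENNReal.tsum_mul_right]
  rw [ENNReal.tsum_comm]
  simp only [mul_assoc]

theorem mean_map (p : PMF α) (g : α → β) (f : β → ℝ≥0∞) :
    mean (p.map g) f = mean p fun a => f (g a) := by
  rw [← PMF.bind_pure_comp, mean_bind]
  simp only [Function.comp, mean_pure]

theorem mean_mono {p : PMF α} {f g : α → ℝ≥0∞} (h : ∀ a ∈ p.support, f a ≤ g a) :
    mean p f ≤ mean p g := by
  refine ENNReal.tsum_le_tsum fun a => ?_
  by_cases ha : p a = 0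
  · simp [ha]
  · exact mul_le_mul_right (h a ((PMF.mem_support_iff p a).2 ha)) _

theorem mean_add (p : PMF α) (f g : α → ℝ≥0∞) :
    mean p (fun a => f a + g a) = mean p f + mean p g := by
  simp only [mean, mul_add, ENNReal.tsum_add]

theorem toOuterMeasure_eq_mean (p : PMF α) (s : Set α) :
    p.toOuterMeasure s = mean p (s.indicator 1) := by
  rw [PMF.toOuterMeasure_apply, mean]
  refine tsum_congr fun a => ?_
  by_cases ha : a ∈ s <;> simp [ha]

theorem mean_uniform_le [Fintype α] [Nonempty α] {F : α → ℝ≥0∞} {f : α → ℝ}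
    (hf : ∀ a, 0 ≤ f a) (h : ∀ a, F a ≤ ENNReal.ofReal (f a)) :
    mean (PMF.uniformOfFintype α) F ≤ ENNReal.ofReal (𝔼 a, f a) := by
  have hc : (0 : ℝ) < Fintype.card α := by exact_mod_cast Fintype.card_pos
  rw [mean, tsum_fintype, Fintype.expect_eq_sum_div_card, div_eq_inv_mul,
    ENNReal.ofReal_mul (by positivity), ENNReal.ofReal_inv_of_pos hc, ENNReal.ofReal_natCast,
    ENNReal.ofReal_sum_of_nonneg fun a _ => hf a, Finset.mul_sum]
  refine Finset.sum_le_sum fun a _ => ?_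
  rw [PMF.uniformOfFintype_apply]
  exact mul_le_mul_right (h a) _

theorem mean_uniform_eq [Fintype α] [Nonempty α] {f : α → ℝ} (hf : ∀ a, 0 ≤ f a) :
    mean (PMF.uniformOfFintype α) (fun a => ENNReal.ofReal (f a)) =
      ENNReal.ofReal (𝔼 a, f a) := by
  have hc : (0 : ℝ) < Fintype.card α := by exact_mod_cast Fintype.card_pos
  rw [mean, tsum_fintype, Fintype.expect_eq_sum_div_card, div_eq_inv_mul,
    ENNReal.ofReal_mul (by positivity), ENNReal.ofReal_inv_of_pos hc, ENNReal.ofReal_natCast,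
    ENNReal.ofReal_sum_of_nonneg fun a _ => hf a, Finset.mul_sum]
  simp only [PMF.uniformOfFintype_apply]

/-- A coin that shows `true` with probability `p`. -/
def coin (p : ℝ) (h0 : 0 ≤ p) (h1 : p ≤ 1) : PMF Bool :=
  PMF.ofFintype (fun b => bif b then ENNReal.ofReal p else ENNReal.ofReal (1 - p)) (by
    rw [Fintype.sum_bool, cond_true, cond_false, ← ENNReal.ofReal_add h0 (by linarith),
      add_sub_cancel, ENNReal.ofReal_one])

theorem mean_coin {p : ℝ} (h0 : 0 ≤ p) (h1 : p ≤ 1) (f : Bool → ℝ≥0∞) :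
    mean (coin p h0 h1) f =
      ENNReal.ofReal p * f true + ENNReal.ofReal (1 - p) * f false := by
  rw [mean, tsum_fintype, Fintype.sum_bool]
  simp [coin, PMF.ofFintype_apply]

end Mean

/-! ### Bounding the number of calls by a potential -/

section Drift

variable {P : Params} {L M : Type*} [Field M] [Fintype M]

/-- If the potential decreases by at least `1` on average with every call, then the expected number
of calls is at most the initial potential. -/
theorem Extractor.expectedCalls_le (E : Extractor P L M) (Q : Prover P L M)
    (V : List (Q.Tape × Call P L M) → ℝ≥0∞) (Inv : List (Q.Tape × Call P L M) → Prop)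
    (h0 : Inv [])
    (hstep : ∀ h, Inv h → E.out (h.map Prod.snd) = none → ∀ μ ∈ (E.next (h.map Prod.snd)).support,
      ∀ x ∈ (Q.move h μ.1 μ.2).support, Inv (h ++ [x]))
    (hdrift : ∀ h, Inv h → E.out (h.map Prod.snd) = none →
      1 + mean (E.next (h.map Prod.snd))
        (fun μ => mean (Q.move h μ.1 μ.2) fun x => V (h ++ [x])) ≤ V h) :
    E.expectedCalls Q ≤ V [] := by
  have hinv : ∀ t, ∀ h ∈ (E.run Q t).support, Inv h := by
    intro t
    induction t with
    | zero =>
      intro h hh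
      rw [Extractor.run, PMF.support_pure, Set.mem_singleton_iff] at hh
      exact hh ▸ h0
    | succ t ih =>
      intro h hh
      rw [Extractor.run, PMF.mem_support_bind_iff] at hh
      obtain ⟨h', hh', hh⟩ := hh
      cases hout : E.out (h'.map Prod.snd) with
      | some o =>
        rw [hout] at hh
        rw [PMF.support_pure, Set.mem_singleton_iff] at hh
        exact hh ▸ ih h' hh'
      | none =>
        rw [hout] at hh
        simp only [PMF.mem_support_bind_iff, PMF.mem_support_map_iff] at hh
        obtain ⟨μ, hμ, x, hx, rfl⟩ := hh
        exact hstep h' (ih h' hh') hout μ hμ x hx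
  -- After an output the list, and hence the potential, stays constant; before it the drift
  -- hypothesis pays for one call. Summing over `t` telescopes.
  have hrun : ∀ t, (E.run Q t).toOuterMeasure {h | E.out (h.map Prod.snd) = none} +
      mean (E.run Q (t + 1)) V ≤ mean (E.run Q t) V := by
    intro t
    rw [toOuterMeasure_eq_mean, Extractor.run, mean_bind, ← mean_add]
    refine mean_mono fun h hh => ?_
    cases hout : E.out (h.map Prod.snd) with
    | some o =>
      have : h ∉ {h : List (Q.Tape × Call P L M) | E.out (h.map Prod.snd) = none} := by
        simp [hout]
      rw [Set.indicator_of_notMem this, zero_add]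
      simp only [mean_pure, le_refl]
    | none =>
      have : h ∈ {h : List (Q.Tape × Call P L M) | E.out (h.map Prod.snd) = none} := hout
      rw [Set.indicator_of_mem this, Pi.one_apply]
      simp only [mean_bind, mean_map]
      exact hdrift h (hinv t h hh) hout
  have hsum : ∀ n, ∑ t ∈ Finset.range n,
      (E.run Q t).toOuterMeasure {h | E.out (h.map Prod.snd) = none} + mean (E.run Q n) V ≤
      V [] := by
    intro n
    induction n with
    | zero => simp [Extractor.run, mean_pure]
    | succ n ih =>
      rw [Finset.sum_range_succ, add_assoc]
      exact (add_le_add_right (hrun n) _).trans ih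
  refine ENNReal.tsum_le_of_sum_range_le fun n => ?_
  exact le_self_add.trans (hsum n)

/-! ### The possible results of a call -/

theorem mem_support_call {Q : Prover P L M} {ω : Q.Tape} {s a : ℕ}
    {c? : Option (Challenge₁ P M)} {x : Q.Tape × Call P L M}
    (hx : x ∈ (Q.call ω s a c?).support) :
    ∃ c I, x = (ω, ⟨s, a, Q.transcript ω c I⟩) ∧ ∀ c' ∈ c?, c = c' := by
  rw [Prover.call, PMF.mem_support_bind_iff] at hx
  obtain ⟨c, hc, hx⟩ := hx
  rw [PMF.mem_support_map_iff] at hx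
  obtain ⟨I, -, rfl⟩ := hx
  refine ⟨c, I, rfl, fun c' hc' => ?_⟩
  rw [Option.mem_def] at hc'
  subst hc'
  simpa using hc

theorem mem_support_freshCall {Q : Prover P L M} {s a : ℕ}
    {x : Q.Tape × Call P L M} (hx : x ∈ (Q.freshCall s a).support) :
    ∃ ω c I, x = (ω, ⟨s, a, Q.transcript ω c I⟩) := by
  rw [Prover.freshCall, PMF.mem_support_bind_iff] at hx
  obtain ⟨ω, -, hx⟩ := hx
  obtain ⟨c, I, rfl, -⟩ := mem_support_call hx
  exact ⟨ω, c, I, rfl⟩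

theorem move_rewindCommit_last (Q : Prover P L M) (h : List (Q.Tape × Call P L M))
    (y : Q.Tape × Call P L M) (a : ℕ) :
    Q.move (h ++ [y]) a (.rewindCommit ((h ++ [y]).length - 1)) =
      Q.call y.1 y.2.session a none := by
  simp [Prover.move]

theorem move_rewindResponse_last (Q : Prover P L M) (h : List (Q.Tape × Call P L M))
    (y : Q.Tape × Call P L M) (a : ℕ) :
    Q.move (h ++ [y]) a (.rewindResponse ((h ++ [y]).length - 1)) =
      Q.call y.1 y.2.session a (some y.2.T.ch₁) := by
  simp [Prover.move]

end Drift

/-! ### Acceptance probabilities -/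

section Probabilities

variable {P : Params} {K L M : Type*} [Field K] [Field L] [Field M]
  [Fintype K] [Algebra K L] [Algebra L M] [Algebra K M]

open Classical in
/-- The second challenges accepted on tape `ω` after the first challenge `c`. -/
def Prover.acceptedSet (D : PublicData P K L M) (Q : Prover P L M) (ω : Q.Tape)
    (c : Challenge₁ P M) : Finset (Challenge₂ P) :=
  Finset.univ.filter fun I => (Q.transcript ω c I).Accepted D

/-- The acceptance probability on tape `ω` after the first challenge `c`. -/
def Prover.acceptProb₁ (D : PublicData P K L M) (Q : Prover P L M) (ω : Q.Tape)
    (c : Challenge₁ P M) : ℝ :=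
  (Q.acceptedSet D ω c).card / Fintype.card (Challenge₂ P)

/-- The acceptance probability on tape `ω`. -/
def Prover.tapeProb [Fintype M] (D : PublicData P K L M) (Q : Prover P L M)
    (ω : Q.Tape) : ℝ :=
  𝔼 c, Q.acceptProb₁ D ω c

theorem card_challenge₂ (P : Params) : Fintype.card (Challenge₂ P) = P.N.choose P.ℓ := by
  simp [Challenge₂]

theorem card_challenge₂_pos (P : Params) : (0 : ℝ) < Fintype.card (Challenge₂ P) := by
  exact_mod_cast Fintype.card_pos

theorem Prover.mem_acceptedSet (D : PublicData P K L M) (Q : Prover P L M) (ω : Q.Tape)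
    (c : Challenge₁ P M) (I : Challenge₂ P) :
    I ∈ Q.acceptedSet D ω c ↔ (Q.transcript ω c I).Accepted D := by
  simp [Prover.acceptedSet]

theorem Prover.acceptProb₁_nonneg (D : PublicData P K L M) (Q : Prover P L M) (ω : Q.Tape)
    (c : Challenge₁ P M) : 0 ≤ Q.acceptProb₁ D ω c := by
  unfold Prover.acceptProb₁; positivity

theorem Prover.acceptProb₁_le_one (D : PublicData P K L M) (Q : Prover P L M) (ω : Q.Tape)
    (c : Challenge₁ P M) : Q.acceptProb₁ D ω c ≤ 1 := by
  unfold Prover.acceptProb₁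
  rw [div_le_one (card_challenge₂_pos P)]
  exact_mod_cast Finset.card_le_univ _

theorem Prover.tapeProb_nonneg [Fintype M] (D : PublicData P K L M) (Q : Prover P L M)
    (ω : Q.Tape) :
    0 ≤ Q.tapeProb D ω :=
  Finset.expect_nonneg fun c _ => Q.acceptProb₁_nonneg D ω c

theorem Prover.tapeProb_le_one [Fintype M] (D : PublicData P K L M) (Q : Prover P L M)
    (ω : Q.Tape) :
    Q.tapeProb D ω ≤ 1 :=
  Finset.expect_le Finset.univ_nonempty fun c _ => Q.acceptProb₁_le_one D ω c

/-- The mean over the second challenge of a quantity that depends only on acceptance. -/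
theorem Prover.expect_ite_accepted (D : PublicData P K L M) (Q : Prover P L M) (ω : Q.Tape)
    (c : Challenge₁ P M) (X Y : ℝ) :
    𝔼 I, (if I ∈ Q.acceptedSet D ω c then X else Y) =
      (1 - Q.acceptProb₁ D ω c) * Y + Q.acceptProb₁ D ω c * X := by
  have hC := (card_challenge₂_pos P).ne'
  have : ∀ I, (if I ∈ Q.acceptedSet D ω c then X else Y) =
      Y + if I ∈ Q.acceptedSet D ω c then X - Y else 0 := fun I => by split_ifs <;> ring
  simp_rw [this]
  rw [Fintype.expect_eq_sum_div_card, Finset.sum_add_distrib, Finset.sum_ite_mem,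
    Finset.univ_inter, Finset.sum_const, Finset.sum_const, Finset.card_univ, nsmul_eq_mul,
    nsmul_eq_mul, Prover.acceptProb₁]
  field_simp
  ring

theorem Prover.acceptProb_eq [Fintype M] (D : PublicData P K L M) (Q : Prover P L M) :
    Q.acceptProb D = 𝔼 ω, Q.tapeProb D ω := by
  have h : Q.execution.toOuterMeasure {T | T.Accepted D} =
      ENNReal.ofReal (𝔼 ω, Q.tapeProb D ω) := by
    rw [toOuterMeasure_eq_mean, Prover.execution, mean_bind,
      ← mean_uniform_eq (Q.tapeProb_nonneg D)]
    congr 1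
    funext ω
    rw [mean_bind, Prover.tapeProb, ← mean_uniform_eq (Q.acceptProb₁_nonneg D ω)]
    congr 1
    funext c
    have := Q.expect_ite_accepted D ω c 1 0
    rw [mul_zero, mul_one, zero_add] at this
    rw [mean_map, ← this, ← mean_uniform_eq fun I => by split_ifs <;> norm_num]
    congr 1
    funext I
    by_cases hI : (Q.transcript ω c I).Accepted D
    · rw [Set.indicator_of_mem (by exact hI), if_pos ((Q.mem_acceptedSet D ω c I).2 hI)]
      simp
    · rw [Set.indicator_of_notMem (by exact hI),
        if_neg fun h => hI ((Q.mem_acceptedSet D ω c I).1 h)]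
      simp
  rw [Prover.acceptProb, h, ENNReal.toReal_ofReal]
  exact Finset.expect_nonneg fun ω _ => Q.tapeProb_nonneg D ω

open Classical in
/-- The fraction of the accepted second challenges with progress. -/
def Prover.progressRatio [Fintype L] (D : PublicData P K L M) (Q : Prover P L M)
    (κ : Set (ℕ × Transcript P L M)) (s : ℕ) (ω : Q.Tape) (c : Challenge₁ P M) : ℝ :=
  (((Q.acceptedSet D ω c).filter fun I => Progress D κ s (Q.transcript ω c I)).card : ℝ) /
    (Q.acceptedSet D ω c).card

theorem Prover.progressRatio_nonneg [Fintype L] (D : PublicData P K L M) (Q : Prover P L M)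
    (κ : Set (ℕ × Transcript P L M)) (s : ℕ) (ω : Q.Tape) (c : Challenge₁ P M) :
    0 ≤ Q.progressRatio D κ s ω c := by
  unfold Prover.progressRatio; positivity

theorem Prover.progressRatio_le_one [Fintype L] (D : PublicData P K L M) (Q : Prover P L M)
    (κ : Set (ℕ × Transcript P L M)) (s : ℕ) (ω : Q.Tape) (c : Challenge₁ P M) :
    Q.progressRatio D κ s ω c ≤ 1 := by
  classical
  unfold Prover.progressRatio
  refine div_le_one_of_le₀ ?_ (Nat.cast_nonneg _)
  exact_mod_cast Finset.card_filter_le _ _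

/-- A lower bound for the fraction of the accepted second challenges with progress. -/
theorem Prover.le_progressRatio [Fintype L] [IsScalarTower K L M] {D : PublicData P K L M}
    (Q : Prover P L M) {κ : Set (ℕ × Transcript P L M)} (hκ : Coherent D κ) {s : ℕ} {ω : Q.Tape}
    {c : Challenge₁ P M} {I : Challenge₂ P} (hI : (s, Q.transcript ω c I) ∈ κ)
    {st : Fin P.N → State P L M} (hst : ∀ i m, Opened κ s i m → m = st i) :
    1 - (1 + (P.ℓ : ℝ) * (falsePositives D κ s st c).card) / (Q.acceptedSet D ω c).card ≤
      Q.progressRatio D κ s ω c := by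
  classical
  have hpos : (0 : ℝ) < (Q.acceptedSet D ω c).card := by
    have : I ∈ Q.acceptedSet D ω c := (Q.mem_acceptedSet D ω c I).2 (hκ.accepted _ hI)
    exact_mod_cast Finset.card_pos.2 ⟨I, this⟩
  have h := card_not_progress_le hκ hI hst (fun I => Q.transcript ω c I) (fun _ => rfl)
    (fun _ => rfl) (fun _ => rfl) (fun _ => rfl)
    ((Q.acceptedSet D ω c).filter fun I => ¬ Progress D κ s (Q.transcript ω c I))
    (fun I' hI' => ⟨(Q.mem_acceptedSet D ω c I').1 (Finset.mem_filter.1 hI').1,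
      (Finset.mem_filter.1 hI').2⟩)
  have hadd := Finset.card_filter_add_card_filter_not (s := Q.acceptedSet D ω c)
    (fun I => Progress D κ s (Q.transcript ω c I))
  have h' : (((Q.acceptedSet D ω c).filter
      fun I => ¬ Progress D κ s (Q.transcript ω c I)).card : ℝ) ≤
      1 + P.ℓ * (falsePositives D κ s st c).card := by exact_mod_cast h
  have hadd' : (((Q.acceptedSet D ω c).filter
      fun I => Progress D κ s (Q.transcript ω c I)).card : ℝ) +
      ((Q.acceptedSet D ω c).filter fun I => ¬ Progress D κ s (Q.transcript ω c I)).card =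
      (Q.acceptedSet D ω c).card := by exact_mod_cast hadd
  unfold Prover.progressRatio
  rw [sub_le_iff_le_add, ← add_div, one_le_div hpos]
  linarith

/-- The cost of one round (a call with a random first challenge), averaged over the challenges. -/
theorem Prover.expect_round_le [Fintype M] (D : PublicData P K L M) (Q : Prover P L M) (ω : Q.Tape)
    {A B Y u Δ ε : ℝ} (hBΔ : 0 ≤ B * Δ) (m : Challenge₁ P M → ℝ) (hm : ∀ c, 0 ≤ m c)
    (hmε : ∑ c, m c ≤ Fintype.card (Challenge₁ P M) * (P.N.choose P.ℓ * ε)) :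
    𝔼 c, 𝔼 I, (if I ∈ Q.acceptedSet D ω c then
        A + 1 / Q.acceptProb₁ D ω c + B * (1 - u) -
          B * Δ * max (1 - m c / (Q.acceptedSet D ω c).card) 0 else Y) ≤
      (1 - Q.tapeProb D ω) * Y + Q.tapeProb D ω * (A + B * (1 - u)) + 1 -
        B * Δ * max (Q.tapeProb D ω - ε) 0 := by
  have hC := card_challenge₂_pos P
  have hN := card_challenge₂ P
  have hcard₁ : (0 : ℝ) < Fintype.card (Challenge₁ P M) := by exact_mod_cast Fintype.card_pos
  -- A lower bound for the probability, given `c`, that the round is accepted and its repetition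
  -- makes progress. The truncation at `0` keeps the bound nonnegative when few challenges are
  -- accepted.
  let t : Challenge₁ P M → ℝ := fun c =>
    Q.acceptProb₁ D ω c * max (1 - m c / (Q.acceptedSet D ω c).card) 0
  have ht0 : ∀ c, 0 ≤ t c := fun c => mul_nonneg (Q.acceptProb₁_nonneg D ω c) (le_max_right _ _)
  have ht : ∀ c, Q.acceptProb₁ D ω c - m c / Fintype.card (Challenge₂ P) ≤ t c := by
    intro c
    rcases Nat.eq_zero_or_pos (Q.acceptedSet D ω c).card with h | h
    · have : Q.acceptProb₁ D ω c = 0 := by simp [Prover.acceptProb₁, h]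
      have h2 := ht0 c
      have h3 : 0 ≤ m c / Fintype.card (Challenge₂ P) := div_nonneg (hm c) hC.le
      linarith
    · have h' : (0 : ℝ) < (Q.acceptedSet D ω c).card := by exact_mod_cast h
      have : Q.acceptProb₁ D ω c - m c / Fintype.card (Challenge₂ P) =
          Q.acceptProb₁ D ω c * (1 - m c / (Q.acceptedSet D ω c).card) := by
        rw [Prover.acceptProb₁]
        field_simp
      rw [this]
      exact mul_le_mul_of_nonneg_left (le_max_left _ _) (Q.acceptProb₁_nonneg D ω c)
  have hEt : max (Q.tapeProb D ω - ε) 0 ≤ 𝔼 c, t c := by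
    refine max_le ?_ (Finset.expect_nonneg fun c _ => ht0 c)
    calc Q.tapeProb D ω - ε
        ≤ 𝔼 c, (Q.acceptProb₁ D ω c - m c / Fintype.card (Challenge₂ P)) := by
          rw [Finset.expect_sub_distrib, Prover.tapeProb]
          refine sub_le_sub_left ?_ _
          rw [Fintype.expect_eq_sum_div_card, ← Finset.sum_div, hN,
            div_le_iff₀ hcard₁, div_le_iff₀ (by rw [← hN]; exact hC)]
          linarith
      _ ≤ 𝔼 c, t c := Finset.expect_le_expect fun c _ => ht c
  have hpt : ∀ c, 𝔼 I, (if I ∈ Q.acceptedSet D ω c then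
        A + 1 / Q.acceptProb₁ D ω c + B * (1 - u) -
          B * Δ * max (1 - m c / (Q.acceptedSet D ω c).card) 0 else Y) ≤
      (Y + 1 + Q.acceptProb₁ D ω c * (A + B * (1 - u) - Y)) - B * Δ * t c := by
    intro c
    rw [Q.expect_ite_accepted]
    -- The mean waiting time for the second acceptance is paid only after a first one, so it costs
    -- at most one call on average (`0` if nothing is accepted, by `1 / 0 = 0`).
    have h1 : Q.acceptProb₁ D ω c * (1 / Q.acceptProb₁ D ω c) ≤ 1 := by
      rw [mul_one_div]; exact div_self_le_one _
    simp only [t]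
    nlinarith
  refine (Finset.expect_le_expect fun c _ => hpt c).trans ?_
  rw [Finset.expect_sub_distrib, Finset.expect_add_distrib, ← Finset.mul_expect,
    ← Finset.expect_mul, Fintype.expect_const]
  have := mul_le_mul_of_nonneg_left hEt hBΔ
  have e : 𝔼 c, Q.acceptProb₁ D ω c = Q.tapeProb D ω := rfl
  rw [e]
  linarith

end Probabilities

/-! ### The extractor -/

section Extraction

variable {P : Params} {K L M : Type*} [Field K] [Field L] [Field M]
  [Fintype K] [Algebra K L] [Algebra L M] [Algebra K M]

/-- What the extractor does next: start a new session, draw new challenges in the current session,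
or repeat the first challenge of the last call. -/
inductive Mode where
  | fresh
  | commit
  | response

open Classical in
/-- The mode after a call.  The memory of a call is `0`, `1`, `2` if it was made in the mode
`fresh`, `commit`, `response`. -/
def Call.mode (D : PublicData P K L M) (C : Call P L M) : Mode :=
  if C.T.Accepted D then if C.memo = 2 then .commit else .response
  else if C.memo = 0 then .fresh else if C.memo = 1 then .commit else .response

/-- A call with a new first challenge leads to repetition only through acceptance. -/
theorem Call.accepted_of_mode_eq_response {D : PublicData P K L M} {C : Call P L M}
    (hm : C.mode D = .response) (hC : C.memo = 0 ∨ C.memo = 1) : C.T.Accepted D := by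
  by_contra hacc
  rw [Call.mode, if_neg hacc] at hm
  rcases hC with hC | hC <;> simp [hC] at hm

/-- The mode after a list of calls. -/
def lastMode (D : PublicData P K L M) (h : List (Call P L M)) : Mode :=
  (h.getLast?.map (Call.mode D)).getD .fresh

open Classical in
/-- The extractor.  New sessions are started until a call is accepted.  After an accepted call with
a new first challenge, that challenge is repeated until the next acceptance, in order to find a
collision of the hash function; then new first challenges are drawn, except that before each such
call the session is given up with probability `p`.  The extractor stops as soon as a valid output
can be read off. -/
def extractor [Fintype L] (D : PublicData P K L M) (p : ℝ) (h0 : 0 ≤ p) (h1 : p ≤ 1) :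
    Extractor P L M where
  next h := match lastMode D h with
    | .fresh => PMF.pure (0, .fresh)
    | .commit => (coin p h0 h1).map fun b =>
        bif b then (0, .fresh) else (1, .rewindCommit (h.length - 1))
    | .response => PMF.pure (2, .rewindResponse (h.length - 1))
  out h := if hf : Found D (knowledge D h) then some hf.choose else none

theorem extractor_correct [Fintype L] (D : PublicData P K L M) (p : ℝ) (h0 : 0 ≤ p)
    (h1 : p ≤ 1) : (extractor D p h0 h1).Correct D := by
  intro h o ho
  simp only [extractor] at ho
  split_ifs at ho with hf
  obtain rfl := Option.some_inj.1 ho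
  exact ⟨hf.choose_spec.1, hf.choose_spec.2.readOff⟩

theorem extractor_out_eq_none [Fintype L] {D : PublicData P K L M} {p : ℝ} {h0 : 0 ≤ p}
    {h1 : p ≤ 1} {h : List (Call P L M)} :
    (extractor D p h0 h1).out h = none ↔ ¬ Found D (knowledge D h) := by
  simp only [extractor]
  split_ifs with hf <;> simp [hf]

/-! ### Reachable lists of calls -/

/-- The properties of the lists of calls that the extractor can produce. -/
structure Reachable (D : PublicData P K L M) (Q : Prover P L M)
    (h : List (Q.Tape × Call P L M)) : Prop where
  transcript_eq : ∀ x ∈ h, x.2.T = Q.transcript x.1 x.2.T.ch₁ x.2.T.ch₂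
  session_lt : ∀ x ∈ h, x.2.session < h.length
  tape_eq : ∀ x ∈ h, ∀ y ∈ h, x.2.session = y.2.session → x.1 = y.1
  exists_accepted : ∀ x ∈ h, x.2.mode D = .response →
    ∃ I, (Q.transcript x.1 x.2.T.ch₁ I).Accepted D

/-- All earlier session numbers are below the length of the list, so the length is an unused number.
-/
theorem Reachable.append_fresh {D : PublicData P K L M} {Q : Prover P L M}
    {h : List (Q.Tape × Call P L M)} (hR : Reachable D Q h) (ω : Q.Tape) (c : Challenge₁ P M)
    (I : Challenge₂ P) :
    Reachable D Q (h ++ [(ω, ⟨h.length, 0, Q.transcript ω c I⟩)]) where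
  transcript_eq x hx := by
    rcases List.mem_append.1 hx with hx | hx
    · exact hR.transcript_eq x hx
    · rw [List.mem_singleton.1 hx]; rfl
  session_lt x hx := by
    rw [List.length_append, List.length_singleton]
    rcases List.mem_append.1 hx with hx | hx
    · exact (hR.session_lt x hx).trans (Nat.lt_succ_self _)
    · rw [List.mem_singleton.1 hx]; exact Nat.lt_succ_self _
  tape_eq x hx y hy hs := by
    rcases List.mem_append.1 hx with hx | hx <;> rcases List.mem_append.1 hy with hy | hy
    · exact hR.tape_eq x hx y hy hs
    · rw [List.mem_singleton.1 hy] at hs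
      exact absurd hs (hR.session_lt x hx).ne
    · rw [List.mem_singleton.1 hx] at hs
      exact absurd hs.symm (hR.session_lt y hy).ne
    · rw [List.mem_singleton.1 hx, List.mem_singleton.1 hy]
  exists_accepted x hx hm := by
    rcases List.mem_append.1 hx with hx | hx
    · exact hR.exists_accepted x hx hm
    · rw [List.mem_singleton.1 hx] at hm ⊢
      exact ⟨I, Call.accepted_of_mode_eq_response hm (Or.inl rfl)⟩

/-- A repetition keeps tape and first challenge, so it inherits an accepted second challenge from
`y` even if it is itself rejected. This keeps the waiting time in the potential meaningful. -/
theorem Reachable.append_rewind {D : PublicData P K L M} {Q : Prover P L M}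
    {h : List (Q.Tape × Call P L M)} (hR : Reachable D Q h) {y : Q.Tape × Call P L M}
    (hy : y ∈ h) {a : ℕ} {c : Challenge₁ P M} {I : Challenge₂ P}
    (hac : a = 1 ∨ a = 2 ∧ c = y.2.T.ch₁ ∧ y.2.mode D = .response) :
    Reachable D Q (h ++ [(y.1, ⟨y.2.session, a, Q.transcript y.1 c I⟩)]) where
  transcript_eq x hx := by
    rcases List.mem_append.1 hx with hx | hx
    · exact hR.transcript_eq x hx
    · rw [List.mem_singleton.1 hx]; rfl
  session_lt x hx := by
    rw [List.length_append, List.length_singleton]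
    rcases List.mem_append.1 hx with hx | hx
    · exact (hR.session_lt x hx).trans (Nat.lt_succ_self _)
    · rw [List.mem_singleton.1 hx]; exact (hR.session_lt y hy).trans (Nat.lt_succ_self _)
  tape_eq x hx z hz hs := by
    rcases List.mem_append.1 hx with hx | hx <;> rcases List.mem_append.1 hz with hz | hz
    · exact hR.tape_eq x hx z hz hs
    · rw [List.mem_singleton.1 hz] at hs ⊢
      exact hR.tape_eq x hx y hy hs
    · rw [List.mem_singleton.1 hx] at hs ⊢
      exact hR.tape_eq y hy z hz hs
    · rw [List.mem_singleton.1 hx, List.mem_singleton.1 hz]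
  exists_accepted x hx hm := by
    rcases List.mem_append.1 hx with hx | hx
    · exact hR.exists_accepted x hx hm
    · rw [List.mem_singleton.1 hx] at hm ⊢
      rcases hac with rfl | ⟨rfl, rfl, hresp⟩
      · exact ⟨I, Call.accepted_of_mode_eq_response hm (Or.inr rfl)⟩
      · exact hR.exists_accepted y hy hresp

/-- Calls of one session share the tape, and the commitment is a function of the tape alone. -/
theorem Reachable.coherent {D : PublicData P K L M} {Q : Prover P L M}
    {h : List (Q.Tape × Call P L M)} (hR : Reachable D Q h) :
    Coherent D (knowledge D (h.map Prod.snd)) where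
  accepted p hp := hp.1
  root_eq := by
    rintro ⟨s, _⟩ ⟨-, C, hC, rfl, rfl⟩ ⟨s', _⟩ ⟨-, C', hC', rfl, rfl⟩ hs
    obtain ⟨x, hx, rfl⟩ := List.mem_map.1 hC
    obtain ⟨x', hx', rfl⟩ := List.mem_map.1 hC'
    have := hR.tape_eq x hx x' hx' hs
    simp only
    rw [hR.transcript_eq x hx, hR.transcript_eq x' hx', this]
    rfl

theorem lastMode_append (D : PublicData P K L M) (h : List (Call P L M)) (C : Call P L M) :
    lastMode D (h ++ [C]) = C.mode D := by
  simp [lastMode]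

theorem eq_append_of_lastMode_ne_fresh {α : Type*} {D : PublicData P K L M}
    {h : List (α × Call P L M)} (hm : lastMode D (h.map Prod.snd) ≠ .fresh) :
    ∃ h' y, h = h' ++ [y] ∧ y.2.mode D = lastMode D (h.map Prod.snd) := by
  rcases List.eq_nil_or_concat h with rfl | ⟨h', y, rfl⟩
  · exact absurd rfl hm
  · exact ⟨h', y, List.concat_eq_append, by simp [lastMode]⟩

theorem Reachable.step [Fintype L] [Fintype M] {D : PublicData P K L M} {Q : Prover P L M}
    {h : List (Q.Tape × Call P L M)} (hR : Reachable D Q h) {p : ℝ} {h0 : 0 ≤ p} {h1 : p ≤ 1}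
    {μ : ℕ × Move} (hμ : μ ∈ ((extractor D p h0 h1).next (h.map Prod.snd)).support)
    {x : Q.Tape × Call P L M} (hx : x ∈ (Q.move h μ.1 μ.2).support) :
    Reachable D Q (h ++ [x]) := by
  have hfresh : ∀ x ∈ (Q.move h 0 .fresh).support, Reachable D Q (h ++ [x]) := by
    intro x hx
    obtain ⟨ω, c, I, rfl⟩ := mem_support_freshCall hx
    exact hR.append_fresh ω c I
  simp only [extractor, List.length_map] at hμ
  cases hm : lastMode D (h.map Prod.snd) with
  | fresh =>
    rw [hm] at hμ
    simp only [PMF.support_pure, Set.mem_singleton_iff] at hμ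
    subst hμ
    exact hfresh x hx
  | commit =>
    obtain ⟨h', y, rfl, hy⟩ := eq_append_of_lastMode_ne_fresh (D := D) (h := h) (by simp [hm])
    rw [hm] at hμ
    simp only [PMF.mem_support_map_iff] at hμ
    obtain ⟨b, -, rfl⟩ := hμ
    cases b with
    | true => exact hfresh x hx
    | false =>
      simp only [cond_false, move_rewindCommit_last] at hx
      obtain ⟨c, I, rfl, -⟩ := mem_support_call hx
      exact hR.append_rewind (by simp) (Or.inl rfl)
  | response =>
    obtain ⟨h', y, rfl, hy⟩ := eq_append_of_lastMode_ne_fresh (D := D) (h := h) (by simp [hm])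
    rw [hm] at hμ
    simp only [PMF.support_pure, Set.mem_singleton_iff] at hμ
    subst hμ
    simp only [move_rewindResponse_last] at hx
    obtain ⟨c, I, rfl, hc⟩ := mem_support_call hx
    exact hR.append_rewind (by simp) (Or.inr ⟨rfl, hc _ rfl, hy.trans hm⟩)

end Extraction

/-! ### The potential -/

/-- For `t = 1` this is `1 - ρ ^ n`. It keeps the real potentials nonnegative, so that
`ENNReal.ofReal` loses nothing. -/
theorem one_sub_pow_sub_mul_nonneg {ρ t : ℝ} (h0 : 0 ≤ ρ) (h1 : ρ ≤ 1) (ht : t ≤ 1) (n : ℕ) :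
    0 ≤ (1 - ρ ^ (n + 1)) - (ρ ^ n - ρ ^ (n + 1)) * t := by
  have h2 : ρ ^ (n + 1) ≤ ρ ^ n := pow_le_pow_of_le_one h0 h1 n.le_succ
  have h3 : ρ ^ n ≤ 1 := pow_le_one₀ h0 h1
  nlinarith

/-- The mean of a function that is constant on a subset of `S`, on the rest of `S`, and outside
`S`. -/
theorem expect_ite_ite {α : Type*} [Fintype α] [Nonempty α] [DecidableEq α] {S S' : Finset α}
    (hS : S' ⊆ S) (X₁ X₂ V : ℝ) :
    𝔼 a, (if a ∈ S then if a ∈ S' then X₁ else X₂ else V) =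
      V + (S.card * (X₂ - V) + S'.card * (X₁ - X₂)) / Fintype.card α := by
  have hC : (Fintype.card α : ℝ) ≠ 0 := by exact_mod_cast Fintype.card_ne_zero
  have hpt : ∀ a, (if a ∈ S then if a ∈ S' then X₁ else X₂ else V) =
      V + ((if a ∈ S then X₂ - V else 0) + if a ∈ S' then X₁ - X₂ else 0) := by
    intro a
    by_cases h2 : a ∈ S'
    · rw [if_pos (hS h2), if_pos h2, if_pos (hS h2), if_pos h2]; ring
    · by_cases h1 : a ∈ S
      · rw [if_pos h1, if_neg h2, if_pos h1, if_neg h2]; ring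
      · rw [if_neg h1, if_neg h1, if_neg h2]; ring
  rw [Finset.expect_congr rfl fun a _ => hpt a, Fintype.expect_eq_sum_div_card,
    Finset.sum_add_distrib, Finset.sum_add_distrib, Finset.sum_ite_mem, Finset.sum_ite_mem,
    Finset.univ_inter, Finset.univ_inter, Finset.sum_const, Finset.sum_const, Finset.sum_const,
    Finset.card_univ, nsmul_eq_mul, nsmul_eq_mul, nsmul_eq_mul, add_div,
    mul_div_cancel_left₀ _ hC]

/-! ### Averaging over the challenges of one call. -/

section Calls

variable {P : Params} {L M : Type*} [Field M] [Fintype M]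

theorem mean_call_none_le (Q : Prover P L M) (ω : Q.Tape) (s a : ℕ)
    {F : Q.Tape × Call P L M → ℝ≥0∞} {f : Challenge₁ P M → Challenge₂ P → ℝ}
    (hf : ∀ c I, 0 ≤ f c I)
    (h : ∀ c I, F (ω, ⟨s, a, Q.transcript ω c I⟩) ≤ ENNReal.ofReal (f c I)) :
    mean (Q.call ω s a none) F ≤ ENNReal.ofReal (𝔼 c, 𝔼 I, f c I) := by
  rw [Prover.call, mean_bind]
  refine mean_uniform_le (fun c => Finset.expect_nonneg fun I _ => hf c I) fun c => ?_
  rw [mean_map]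
  exact mean_uniform_le (hf c) (h c)

theorem mean_call_some_le (Q : Prover P L M) (ω : Q.Tape) (s a : ℕ) (c : Challenge₁ P M)
    {F : Q.Tape × Call P L M → ℝ≥0∞} {f : Challenge₂ P → ℝ} (hf : ∀ I, 0 ≤ f I)
    (h : ∀ I, F (ω, ⟨s, a, Q.transcript ω c I⟩) ≤ ENNReal.ofReal (f I)) :
    mean (Q.call ω s a (some c)) F ≤ ENNReal.ofReal (𝔼 I, f I) := by
  rw [Prover.call, mean_bind, Option.elim_some, mean_pure, mean_map]
  exact mean_uniform_le hf h

end Calls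

section Potential

variable {P : Params} {K L M : Type*} [Field K] [Field L] [Field M]
  [Fintype K] [Fintype M] [Algebra K L] [Algebra L M] [Algebra K M]

/-- The amount by which the acceptance probability on a tape exceeds `ε`. -/
def Prover.excess (D : PublicData P K L M) (Q : Prover P L M) (ε : ℝ) (ω : Q.Tape) : ℝ :=
  max (Q.tapeProb D ω - ε) 0

/-- A lower bound for the probability to make progress before the session is given up. -/
def Prover.ratio (D : PublicData P K L M) (Q : Prover P L M) (ε μ : ℝ) (ω : Q.Tape) : ℝ :=
  Q.excess D ε ω / (Q.excess D ε ω + μ)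

theorem Prover.excess_nonneg (D : PublicData P K L M) (Q : Prover P L M) (ε : ℝ) (ω : Q.Tape) :
    0 ≤ Q.excess D ε ω := le_max_right _ _

theorem Prover.excess_le (D : PublicData P K L M) (Q : Prover P L M) {ε : ℝ} (hε : 0 ≤ ε)
    (ω : Q.Tape) : Q.excess D ε ω ≤ Q.tapeProb D ω :=
  max_le (by linarith) (Q.tapeProb_nonneg D ω)

theorem Prover.ratio_nonneg (D : PublicData P K L M) (Q : Prover P L M) (ε : ℝ) {μ : ℝ}
    (hμ : 0 < μ) (ω : Q.Tape) : 0 ≤ Q.ratio D ε μ ω :=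
  div_nonneg (Q.excess_nonneg D ε ω) (add_nonneg (Q.excess_nonneg D ε ω) hμ.le)

theorem Prover.ratio_le_one (D : PublicData P K L M) (Q : Prover P L M) (ε : ℝ) {μ : ℝ}
    (hμ : 0 < μ) (ω : Q.Tape) : Q.ratio D ε μ ω ≤ 1 :=
  div_le_one_of_le₀ (by linarith) (add_nonneg (Q.excess_nonneg D ε ω) hμ.le)

variable [Fintype L]

/-- The potential after the call `x`, when the accepted transcripts are `κ` and contain no
output. -/
def callPotential (D : PublicData P K L M) (Q : Prover P L M) (ε μ A B : ℝ)
    (κ : Set (ℕ × Transcript P L M)) (x : Q.Tape × Call P L M) : ℝ :=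
  let ρ := Q.ratio D ε μ x.1
  let n := P.N - (openedParties κ x.2.session).card
  match x.2.mode D with
  | .fresh => B
  | .commit => A + B * (1 - ρ ^ (n + 1))
  | .response => A + 1 / Q.acceptProb₁ D x.1 x.2.T.ch₁ + B * ((1 - ρ ^ (n + 1)) -
      (ρ ^ n - ρ ^ (n + 1)) * Q.progressRatio D κ x.2.session x.1 x.2.T.ch₁)

open Classical in
/-- The potential of a list of calls: a bound for the expected number of further calls. -/
def potential (D : PublicData P K L M) (Q : Prover P L M) (ε μ A B : ℝ)
    (h : List (Q.Tape × Call P L M)) : ℝ≥0∞ :=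
  if Found D (knowledge D (h.map Prod.snd)) then 0
  else match h.getLast? with
    | none => ENNReal.ofReal B
    | some x => ENNReal.ofReal (callPotential D Q ε μ A B (knowledge D (h.map Prod.snd)) x)

variable {D : PublicData P K L M} {Q : Prover P L M} {ε μ A B : ℝ}

theorem potential_append_of_not_accepted {h : List (Q.Tape × Call P L M)}
    {x : Q.Tape × Call P L M} (hf : ¬ Found D (knowledge D (h.map Prod.snd)))
    (hx : ¬ x.2.T.Accepted D) : potential D Q ε μ A B (h ++ [x]) =
      ENNReal.ofReal (callPotential D Q ε μ A B (knowledge D (h.map Prod.snd)) x) := by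
  rw [potential, List.map_append, List.map_singleton, knowledge_append_of_not_accepted D _ hx,
    if_neg hf, List.getLast?_concat]

theorem potential_append_of_accepted_le {h : List (Q.Tape × Call P L M)}
    {x : Q.Tape × Call P L M} {y : ℝ} (hx : x.2.T.Accepted D)
    (hy : ¬ Found D (insert (x.2.session, x.2.T) (knowledge D (h.map Prod.snd))) →
      callPotential D Q ε μ A B
        (insert (x.2.session, x.2.T) (knowledge D (h.map Prod.snd))) x ≤ y) :
    potential D Q ε μ A B (h ++ [x]) ≤ ENNReal.ofReal y := by
  rw [potential, List.map_append, List.map_singleton, knowledge_append_of_accepted D _ hx,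
    List.getLast?_concat]
  split_ifs with hf
  · exact zero_le
  · exact ENNReal.ofReal_le_ofReal (hy hf)

/-- The potential after an accepted call with a new first challenge. -/
theorem potential_round_le (hμ : 0 < μ) (hB : 0 ≤ B) {h : List (Q.Tape × Call P L M)}
    {κ : Set (ℕ × Transcript P L M)} (hκ : κ = knowledge D (h.map Prod.snd))
    {ω : Q.Tape} {s a : ℕ} {c : Challenge₁ P M} {I : Challenge₂ P} (ha : a ≠ 2)
    (hacc : (Q.transcript ω c I).Accepted D) {n : ℕ} {m : ℝ} (hm : 0 ≤ m)
    (hn : ¬ Found D (insert (s, Q.transcript ω c I) κ) →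
      P.N - (openedParties (insert (s, Q.transcript ω c I) κ) s).card + 1 ≤ n ∨
      P.N - (openedParties (insert (s, Q.transcript ω c I) κ) s).card = n ∧
        1 - m / (Q.acceptedSet D ω c).card ≤ Q.progressRatio D
          (insert (s, Q.transcript ω c I) κ) s ω c) :
    potential D Q ε μ A B (h ++ [(ω, ⟨s, a, Q.transcript ω c I⟩)]) ≤
      ENNReal.ofReal (A + 1 / Q.acceptProb₁ D ω c + B * (1 - Q.ratio D ε μ ω ^ (n + 1)) -
        B * (Q.ratio D ε μ ω ^ n - Q.ratio D ε μ ω ^ (n + 1)) *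
          max (1 - m / (Q.acceptedSet D ω c).card) 0) := by
  subst hκ
  refine potential_append_of_accepted_le hacc fun hf => ?_
  have hmode : (⟨s, a, Q.transcript ω c I⟩ : Call P L M).mode D = .response := by
    rw [Call.mode, if_pos hacc, if_neg ha]
  have hch : (Q.transcript ω c I).ch₁ = c := rfl
  simp only [callPotential, hmode, hch]
  set κ := insert (s, Q.transcript ω c I) (knowledge D (h.map Prod.snd))
  set ρ := Q.ratio D ε μ ω
  have h0 : 0 ≤ ρ := Q.ratio_nonneg D ε hμ ω
  have h1 : ρ ≤ 1 := Q.ratio_le_one D ε hμ ω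
  have hstep : ∀ j : ℕ, 0 ≤ ρ ^ j - ρ ^ (j + 1) := fun j =>
    sub_nonneg.2 (pow_le_pow_of_le_one h0 h1 j.le_succ)
  have ht1 : max (1 - m / (Q.acceptedSet D ω c).card) 0 ≤ 1 :=
    max_le (by linarith [div_nonneg hm (Nat.cast_nonneg (α := ℝ) (Q.acceptedSet D ω c).card)])
      zero_le_one
  have hπ := Q.progressRatio_nonneg D κ s ω c
  rw [mul_assoc B, add_sub_assoc, ← mul_sub]
  gcongr A + 1 / Q.acceptProb₁ D ω c + B * ?_
  rcases hn hf with hlt | ⟨heq, hle⟩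
  -- A party newly opened by this call already brings the full gain `ρ ^ n - ρ ^ (n + 1)`, and the
  -- claimed factor is at most `1`.
  · have h2 : ρ ^ n ≤ ρ ^ (P.N - (openedParties κ s).card + 1) := pow_le_pow_of_le_one h0 h1 hlt
    have h3 := mul_nonneg (hstep (P.N - (openedParties κ s).card)) hπ
    have h4 := mul_le_mul_of_nonneg_left ht1 (hstep n)
    linarith
  · rw [heq]
    exact sub_le_sub_left (mul_le_mul_of_nonneg_left (max_le hle hπ) (hstep n)) _

/-- The expected potential after a call on a fresh tape. -/
theorem mean_potential_fresh_le [IsScalarTower K L M] (hμ : 0 < μ) (hA : 0 ≤ A) (hB : 0 ≤ B)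
    (hε : 1 ≤ P.N.choose P.ℓ * ε)
    (hmean : 𝔼 ω, ((1 - Q.tapeProb D ω) * B + Q.tapeProb D ω *
        (A + B * (1 - Q.ratio D ε μ ω ^ (P.N - P.ℓ + 1))) + 1 -
        B * (Q.ratio D ε μ ω ^ (P.N - P.ℓ) - Q.ratio D ε μ ω ^ (P.N - P.ℓ + 1)) *
          Q.excess D ε ω) ≤ B - 1)
    {h : List (Q.Tape × Call P L M)} (hR : Reachable D Q h)
    (hf : ¬ Found D (knowledge D (h.map Prod.snd))) :
    mean (Q.freshCall h.length 0) (fun x => potential D Q ε μ A B (h ++ [x])) ≤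
      ENNReal.ofReal (B - 1) := by
  classical
  set κ := knowledge D (h.map Prod.snd) with hκ
  set f : Q.Tape → Challenge₁ P M → Challenge₂ P → ℝ := fun ω c I =>
    if I ∈ Q.acceptedSet D ω c then
      A + 1 / Q.acceptProb₁ D ω c + B * (1 - Q.ratio D ε μ ω ^ (P.N - P.ℓ + 1)) -
        B * (Q.ratio D ε μ ω ^ (P.N - P.ℓ) - Q.ratio D ε μ ω ^ (P.N - P.ℓ + 1)) *
          max (1 - 1 / ((Q.acceptedSet D ω c).card : ℝ)) 0
    else B
  have hf0 : ∀ ω c I, 0 ≤ f ω c I := by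
    intro ω c I
    simp only [f]
    split_ifs
    · rw [mul_assoc B, add_sub_assoc, ← mul_sub]
      refine add_nonneg (add_nonneg hA (one_div_nonneg.2 (Q.acceptProb₁_nonneg D ω c)))
        (mul_nonneg hB (one_sub_pow_sub_mul_nonneg (Q.ratio_nonneg D ε hμ ω)
          (Q.ratio_le_one D ε hμ ω) (max_le ?_ zero_le_one) _))
      rw [sub_le_self_iff]
      positivity
    · exact hB
  have hbound : ∀ ω c I, potential D Q ε μ A B
      (h ++ [(ω, ⟨h.length, 0, Q.transcript ω c I⟩)]) ≤ ENNReal.ofReal (f ω c I) := by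
    intro ω c I
    by_cases hacc : (Q.transcript ω c I).Accepted D
    · simp only [f]
      rw [if_pos ((Q.mem_acceptedSet D ω c I).2 hacc)]
      refine potential_round_le hμ hB hκ (a := 0) (by norm_num) hacc zero_le_one
        fun hnf => Or.inr ?_
      have hco : Coherent D (insert (h.length, Q.transcript ω c I) κ) := by
        have := (hR.append_fresh ω c I).coherent
        rwa [List.map_append, List.map_singleton, knowledge_append_of_accepted D _ hacc] at this
      have hop : ∀ i m, Opened (insert (h.length, Q.transcript ω c I) κ) h.length i m →
          i ∈ I.1 := by
        rintro i m ⟨T, hT | ⟨-, C, hC, hs, -⟩, hi, -⟩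
        · obtain rfl := (Prod.mk.inj hT).2
          exact hi
        · obtain ⟨x, hx, rfl⟩ := List.mem_map.1 hC
          exact absurd hs (hR.session_lt x hx).ne
      have hparties : openedParties (insert (h.length, Q.transcript ω c I) κ) h.length = I.1 := by
        ext i
        rw [mem_openedParties]
        exact ⟨fun ⟨m, hm⟩ => hop i m hm,
          fun hi => ⟨_, Q.transcript ω c I, Or.inl rfl, hi, rfl⟩⟩
      refine ⟨by rw [hparties, I.2], ?_⟩
      let st : Fin P.N → State P L M := fun i =>
        if hi : i ∈ I.1 then ((Q.respond₂ ω c I).opening ⟨i, hi⟩).1 else ⟨0, 0, 0, 0⟩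
      have hst : ∀ i m, Opened (insert (h.length, Q.transcript ω c I) κ) h.length i m →
          m = st i := by
        intro i m hm
        have hi := hop i m hm
        refine hm.unique hco hnf ⟨Q.transcript ω c I, Or.inl rfl, hi, ?_⟩
        simp only [st, dif_pos hi]
        rfl
      -- Only the `ℓ` parties of `I` are open in the new session, so there are no `(ℓ + 1)`-subsets:
      -- `m = 1`, and `1 / binom(N, ℓ) ≤ ε` is enough.
      have hfp : falsePositives D (insert (h.length, Q.transcript ω c I) κ) h.length st c = ∅ := by
        rw [falsePositives, hparties, Finset.powersetCard_eq_empty.2 (by rw [I.2]; omega),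
          Finset.filter_empty]
      have := Q.le_progressRatio hco (Or.inl rfl) hst
      rwa [hfp, Finset.card_empty, Nat.cast_zero, mul_zero, add_zero] at this
    · rw [potential_append_of_not_accepted hf hacc]
      simp only [f]
      rw [if_neg fun h' => hacc ((Q.mem_acceptedSet D ω c I).1 h')]
      simp [callPotential, Call.mode, hacc]
  rw [Prover.freshCall, mean_bind]
  refine (mean_uniform_le (f := fun ω => 𝔼 c, 𝔼 I, f ω c I)
    (fun ω => Finset.expect_nonneg fun c _ => Finset.expect_nonneg fun I _ => hf0 ω c I)
    fun ω => mean_call_none_le Q ω _ _ (hf0 ω) (hbound ω)).trans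
    (ENNReal.ofReal_le_ofReal (le_trans ?_ hmean))
  refine Finset.expect_le_expect fun ω _ => ?_
  refine Q.expect_round_le D ω (m := fun _ => 1) (mul_nonneg hB (sub_nonneg.2 ?_))
    (fun _ => zero_le_one) ?_
  · exact pow_le_pow_of_le_one (Q.ratio_nonneg D ε hμ ω) (Q.ratio_le_one D ε hμ ω)
      (Nat.le_succ _)
  · rw [Finset.sum_const, Finset.card_univ, nsmul_eq_mul]
    gcongr

/-- The expected potential after a call with new challenges in the session of the call `y`. -/
theorem mean_potential_commit_le [IsScalarTower K L M] (hμ : 0 < μ) (hA : 0 ≤ A) (hB : 0 ≤ B)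
    (hε : ε = soundnessError P.N P.ℓ (falsePositiveRate K L M))
    {h : List (Q.Tape × Call P L M)} (hR : Reachable D Q h)
    (hf : ¬ Found D (knowledge D (h.map Prod.snd))) {y : Q.Tape × Call P L M} (hy : y ∈ h)
    {n : ℕ} (hn : n = P.N -
      (openedParties (knowledge D (h.map Prod.snd)) y.2.session).card) :
    mean (Q.call y.1 y.2.session 1 none) (fun x => potential D Q ε μ A B (h ++ [x])) ≤
      ENNReal.ofReal (1 + (A + B * (1 - Q.ratio D ε μ y.1 ^ (n + 1))) -
        B * (Q.ratio D ε μ y.1 ^ n - Q.ratio D ε μ y.1 ^ (n + 1)) * Q.excess D ε y.1) := by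
  classical
  set κ := knowledge D (h.map Prod.snd) with hκ
  set ω := y.1
  set s := y.2.session
  set ρ := Q.ratio D ε μ ω
  have hρ0 : 0 ≤ ρ := Q.ratio_nonneg D ε hμ ω
  have hρ1 : ρ ≤ 1 := Q.ratio_le_one D ε hμ ω
  have hco : Coherent D κ := hR.coherent
  have hex : ∀ i, ∃ m, i ∈ openedParties κ s → Opened κ s i m := fun i => by
    by_cases hi : i ∈ openedParties κ s
    · exact (mem_openedParties.1 hi).imp fun m hm _ => hm
    · exact ⟨⟨0, 0, 0, 0⟩, fun h => absurd h hi⟩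
  -- The states are fixed before the new challenge is drawn, as the average over it requires;
  -- unopened parties get a zero default.
  choose st hst using hex
  set m : Challenge₁ P M → ℝ := fun c => 1 + (P.ℓ : ℝ) * (falsePositives D κ s st c).card with hm
  have hm0 : ∀ c, 0 ≤ m c := fun c => by simp only [m]; positivity
  set f : Challenge₁ P M → Challenge₂ P → ℝ := fun c I =>
    if I ∈ Q.acceptedSet D ω c then
      A + 1 / Q.acceptProb₁ D ω c + B * (1 - ρ ^ (n + 1)) -
        B * (ρ ^ n - ρ ^ (n + 1)) * max (1 - m c / (Q.acceptedSet D ω c).card) 0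
    else A + B * (1 - ρ ^ (n + 1))
  have hf0 : ∀ c I, 0 ≤ f c I := by
    intro c I
    simp only [f]
    split_ifs
    · rw [mul_assoc B, add_sub_assoc, ← mul_sub]
      refine add_nonneg (add_nonneg hA (one_div_nonneg.2 (Q.acceptProb₁_nonneg D ω c)))
        (mul_nonneg hB (one_sub_pow_sub_mul_nonneg hρ0 hρ1 (max_le ?_ zero_le_one) _))
      rw [sub_le_self_iff]
      exact div_nonneg (hm0 c) (Nat.cast_nonneg _)
    · exact add_nonneg hA (mul_nonneg hB (sub_nonneg.2 (pow_le_one₀ hρ0 hρ1)))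
  have hbound : ∀ c I, potential D Q ε μ A B
      (h ++ [(ω, ⟨s, 1, Q.transcript ω c I⟩)]) ≤ ENNReal.ofReal (f c I) := by
    intro c I
    by_cases hacc : (Q.transcript ω c I).Accepted D
    · simp only [f]
      rw [if_pos ((Q.mem_acceptedSet D ω c I).2 hacc)]
      refine potential_round_le hμ hB hκ (a := 1) (by norm_num) hacc (hm0 c) fun hnf => ?_
      have hsub := openedParties_subset_insert κ s (s, Q.transcript ω c I)
      have hle : (openedParties (insert (s, Q.transcript ω c I) κ) s).card ≤ P.N :=
        (Finset.card_le_univ _).trans_eq (Fintype.card_fin _)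
      rcases (Finset.card_le_card hsub).lt_or_eq with hlt | heq
      · left; omega
      · right
        have hpar := Finset.eq_of_subset_of_card_le hsub heq.ge
        refine ⟨by rw [← hpar, hn], ?_⟩
        have hco' : Coherent D (insert (s, Q.transcript ω c I) κ) := by
          have := (hR.append_rewind hy (a := 1) (c := c) (I := I) (Or.inl rfl)).coherent
          rwa [List.map_append, List.map_singleton, knowledge_append_of_accepted D _ hacc] at this
        have hst' : ∀ i m, Opened (insert (s, Q.transcript ω c I) κ) s i m → m = st i := by
          intro i m hm
          have hi : i ∈ openedParties κ s := by
            rw [hpar, mem_openedParties]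
            exact ⟨m, hm⟩
          exact hm.unique hco' hnf ((hst i hi).insert _)
        have := Q.le_progressRatio hco' (Or.inl rfl) hst'
        -- False positives depend on the transcripts only through the set of opened parties, which
        -- did not change.
        rwa [falsePositives, ← hpar] at this
    · rw [potential_append_of_not_accepted hf hacc]
      simp only [f]
      rw [if_neg fun h' => hacc ((Q.mem_acceptedSet D ω c I).1 h')]
      simp [callPotential, Call.mode, hacc, hn, s, ω, ρ, κ]
  refine (mean_call_none_le Q ω _ _ hf0 hbound).trans (ENNReal.ofReal_le_ofReal ?_)
  refine (Q.expect_round_le D ω (ε := ε) (mul_nonneg hB (sub_nonneg.2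
    (pow_le_pow_of_le_one hρ0 hρ1 (Nat.le_add_right n 1)))) m hm0 ?_).trans (le_of_eq ?_)
  · rw [hε]
    exact sum_falsePositives_le hf hst
  · rw [Prover.excess]
    ring

/-- The expected potential after a call with the first challenge of the call `y`. -/
theorem mean_potential_response_le (hμ : 0 < μ) (hA : 0 ≤ A) (hB : 0 ≤ B)
    {h : List (Q.Tape × Call P L M)} (hR : Reachable D Q h)
    (hf : ¬ Found D (knowledge D (h.map Prod.snd))) {y : Q.Tape × Call P L M} (hy : y ∈ h)
    (hmode : y.2.mode D = .response) :
    1 + mean (Q.call y.1 y.2.session 2 (some y.2.T.ch₁))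
      (fun x => potential D Q ε μ A B (h ++ [x])) ≤
      ENNReal.ofReal (callPotential D Q ε μ A B (knowledge D (h.map Prod.snd)) y) := by
  classical
  obtain ⟨I₀, hI₀⟩ := hR.exists_accepted y hy hmode
  set κ := knowledge D (h.map Prod.snd) with hκ
  set V := callPotential D Q ε μ A B κ y with hV
  set ω := y.1
  set s := y.2.session
  set c := y.2.T.ch₁
  set ρ := Q.ratio D ε μ ω
  have hρ0 : 0 ≤ ρ := Q.ratio_nonneg D ε hμ ω
  have hρ1 : ρ ≤ 1 := Q.ratio_le_one D ε hμ ω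
  set n := P.N - (openedParties κ s).card with hn
  have hVeq : V = A + 1 / Q.acceptProb₁ D ω c + B * ((1 - ρ ^ (n + 1)) -
      (ρ ^ n - ρ ^ (n + 1)) * Q.progressRatio D κ s ω c) := by
    simp only [hV, callPotential, hmode, ω, c, ρ, n, s]
  have hV0 : 0 ≤ V := by
    rw [hVeq]
    exact add_nonneg (add_nonneg hA (one_div_nonneg.2 (Q.acceptProb₁_nonneg D ω c)))
      (mul_nonneg hB (one_sub_pow_sub_mul_nonneg hρ0 hρ1 (Q.progressRatio_le_one D κ s ω c) _))
  set X₁ := A + B * (1 - ρ ^ n) with hX₁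
  set X₂ := A + B * (1 - ρ ^ (n + 1)) with hX₂
  have hX₁0 : 0 ≤ X₁ := add_nonneg hA (mul_nonneg hB (sub_nonneg.2 (pow_le_one₀ hρ0 hρ1)))
  have hX₂0 : 0 ≤ X₂ := add_nonneg hA (mul_nonneg hB (sub_nonneg.2 (pow_le_one₀ hρ0 hρ1)))
  set S := Q.acceptedSet D ω c with hS
  set S' := S.filter fun I => Progress D κ s (Q.transcript ω c I) with hS'
  set f : Challenge₂ P → ℝ := fun I => if I ∈ S then if I ∈ S' then X₁ else X₂ else V
  have hf0 : ∀ I, 0 ≤ f I := by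
    intro I
    simp only [f]
    split_ifs <;> assumption
  have hbound : ∀ I, potential D Q ε μ A B
      (h ++ [(ω, ⟨s, 2, Q.transcript ω c I⟩)]) ≤ ENNReal.ofReal (f I) := by
    intro I
    have hS_iff : I ∈ S ↔ (Q.transcript ω c I).Accepted D := Q.mem_acceptedSet D ω c I
    by_cases hacc : (Q.transcript ω c I).Accepted D
    · refine potential_append_of_accepted_le hacc fun hnf => ?_
      have hmode' : (⟨s, 2, Q.transcript ω c I⟩ : Call P L M).mode D = .commit := by
        rw [Call.mode, if_pos hacc, if_pos rfl]
      simp only [callPotential, hmode', f, if_pos (hS_iff.2 hacc)]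
      have hle : (openedParties (insert (s, Q.transcript ω c I) κ) s).card ≤ P.N :=
        (Finset.card_le_univ _).trans_eq (Fintype.card_fin _)
      split_ifs with hp
      · have hp' := ((Finset.mem_filter.1 hp).2).resolve_left hnf
        have hlt : P.N - (openedParties (insert (s, Q.transcript ω c I) κ) s).card + 1 ≤ n := by
          omega
        have := mul_le_mul_of_nonneg_left (pow_le_pow_of_le_one hρ0 hρ1 hlt) hB
        simp only [X₁, ρ] at this ⊢
        linarith
      · have hp' : ¬ Progress D κ s (Q.transcript ω c I) := fun h' =>
          hp (Finset.mem_filter.2 ⟨hS_iff.2 hacc, h'⟩)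
        rw [Progress, not_or, not_lt] at hp'
        have heq := (Finset.card_le_card (openedParties_subset_insert κ s
          (s, Q.transcript ω c I))).antisymm hp'.2
        rw [← heq]
    · rw [potential_append_of_not_accepted hf hacc]
      simp only [f, if_neg fun h' => hacc (hS_iff.1 h')]
      have hmode' : (⟨s, 2, Q.transcript ω c I⟩ : Call P L M).mode D = .response := by
        rw [Call.mode, if_neg hacc]; simp
      have hch : (Q.transcript ω c I).ch₁ = c := rfl
      rw [hVeq]
      simp only [callPotential, hmode', hch]
      exact le_rfl
  have hC := card_challenge₂_pos P
  have hSpos : (0 : ℝ) < S.card := by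
    exact_mod_cast Finset.card_pos.2 ⟨I₀, (Q.mem_acceptedSet D ω c I₀).2 hI₀⟩
  have hsum : 𝔼 I, f I = V + (S.card * (X₂ - V) + S'.card * (X₁ - X₂)) /
      Fintype.card (Challenge₂ P) := by
    exact expect_ite_ite (Finset.filter_subset _ _) X₁ X₂ V
  -- Geometric waiting: `V` is the exact solution of the one-step equation in which rejection
  -- returns to `V` and acceptance leads to `X₁` with progress or to `X₂` without it.
  have hfinal : 1 + 𝔼 I, f I = V := by
    have hπ : Q.progressRatio D κ s ω c = S'.card / S.card := rfl
    have hs : Q.acceptProb₁ D ω c = S.card / Fintype.card (Challenge₂ P) := rfl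
    rw [hπ, hs] at hVeq
    have hSV : S.card * V = S.card * A + Fintype.card (Challenge₂ P) +
        B * (S.card * (1 - ρ ^ (n + 1)) - (ρ ^ n - ρ ^ (n + 1)) * S'.card) := by
      rw [hVeq]
      field_simp
    rw [hsum, hX₁, hX₂, add_div' _ _ _ hC.ne', ← eq_sub_iff_add_eq', div_eq_iff hC.ne']
    linear_combination (-1 : ℝ) * hSV
  calc 1 + mean (Q.call ω s 2 (some c)) (fun x => potential D Q ε μ A B (h ++ [x]))
      ≤ ENNReal.ofReal 1 + ENNReal.ofReal (𝔼 I, f I) := by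
        rw [ENNReal.ofReal_one]
        gcongr
        exact mean_call_some_le Q ω s 2 c hf0 hbound
    _ = ENNReal.ofReal V := by
        rw [← ENNReal.ofReal_add zero_le_one (Finset.expect_nonneg fun I _ => hf0 I), hfinal]

/-- The potential decreases by at least `1` on average with every call. -/
theorem one_add_mean_potential_le [IsScalarTower K L M] (hμ : 0 < μ) (hA : A * μ = 2)
    (hB : 1 ≤ B) (hε : ε = soundnessError P.N P.ℓ (falsePositiveRate K L M))
    (hmean : 𝔼 ω, ((1 - Q.tapeProb D ω) * B + Q.tapeProb D ω *
        (A + B * (1 - Q.ratio D ε μ ω ^ (P.N - P.ℓ + 1))) + 1 -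
        B * (Q.ratio D ε μ ω ^ (P.N - P.ℓ) - Q.ratio D ε μ ω ^ (P.N - P.ℓ + 1)) *
          Q.excess D ε ω) ≤ B - 1)
    {p : ℝ} {h0 : 0 ≤ p} {h1 : p ≤ 1} (hp : p * (1 + μ) = μ)
    {h : List (Q.Tape × Call P L M)} (hR : Reachable D Q h)
    (hf : ¬ Found D (knowledge D (h.map Prod.snd))) :
    1 + mean ((extractor D p h0 h1).next (h.map Prod.snd))
      (fun ν => mean (Q.move h ν.1 ν.2) fun x => potential D Q ε μ A B (h ++ [x])) ≤
      potential D Q ε μ A B h := by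
  have hA0 : 0 ≤ A := by
    by_contra hneg
    push Not at hneg
    nlinarith
  have hB0 : 0 ≤ B := by linarith
  have hCε : 1 ≤ P.N.choose P.ℓ * ε := by
    rw [hε, choose_mul_soundnessError]
    have := falsePositiveRate_nonneg (K := K) (L := L) (M := M)
    have : 0 ≤ (P.ℓ : ℝ) * (falsePositiveRate K L M * P.N.choose (P.ℓ + 1)) := by positivity
    linarith
  have hε0 : 0 ≤ ε := by
    have : (0 : ℝ) < P.N.choose P.ℓ := by exact_mod_cast Nat.choose_pos P.ℓ_lt_N.le
    by_contra hneg
    push Not at hneg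
    nlinarith
  have hfresh := mean_potential_fresh_le hμ hA0 hB0 hCε hmean hR hf
  have hlast : ∀ h' y, h = h' ++ [y] → potential D Q ε μ A B h =
      ENNReal.ofReal (callPotential D Q ε μ A B (knowledge D (h.map Prod.snd)) y) := by
    intro h' y hh
    rw [potential, if_neg hf]
    have : h.getLast? = some y := by rw [hh, List.getLast?_concat]
    rw [this]
  simp only [extractor, List.length_map]
  cases hm : lastMode D (h.map Prod.snd) with
  | fresh =>
    have hpot : potential D Q ε μ A B h = ENNReal.ofReal B := by
      rcases List.eq_nil_or_concat h with hh | ⟨h', y, hh⟩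
      · rw [potential, if_neg hf, hh]
        rfl
      · rw [List.concat_eq_append] at hh
        rw [hlast h' y hh]
        rw [hh, List.map_append, List.map_singleton, lastMode_append] at hm
        simp [callPotential, hm]
    simp only [mean_pure]
    calc _ ≤ ENNReal.ofReal 1 + ENNReal.ofReal (B - 1) := by
          rw [ENNReal.ofReal_one]
          exact add_le_add_right hfresh 1
      _ = potential D Q ε μ A B h := by
          rw [← ENNReal.ofReal_add zero_le_one (by linarith), add_sub_cancel, hpot]
  | response =>
    obtain ⟨h', y, hh, hy⟩ := eq_append_of_lastMode_ne_fresh (D := D) (h := h) (by simp [hm])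
    have hyh : y ∈ h := by simp [hh]
    have hmove := move_rewindResponse_last Q h' y 2
    rw [← hh] at hmove
    simp only [mean_pure, hmove]
    rw [hlast h' y hh]
    exact mean_potential_response_le hμ hA0 hB0 hR hf hyh (hy.trans hm)
  | commit =>
    obtain ⟨h', y, hh, hy⟩ := eq_append_of_lastMode_ne_fresh (D := D) (h := h) (by simp [hm])
    have hyh : y ∈ h := by simp [hh]
    have hmove := move_rewindCommit_last Q h' y 1
    rw [← hh] at hmove
    have hcommit := mean_potential_commit_le hμ hA0 hB0 hε hR hf hyh rfl
    have hpot := hlast h' y hh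
    simp only [callPotential, hy.trans hm] at hpot
    simp only [mean_map, mean_coin, cond_true, cond_false, hmove, hpot]
    set n := P.N - (openedParties (knowledge D (h.map Prod.snd)) y.2.session).card
    set ρ := Q.ratio D ε μ y.1 with hρ
    set g := Q.excess D ε y.1
    have hg0 : 0 ≤ g := Q.excess_nonneg D ε y.1
    have hg1 : g ≤ 1 := (Q.excess_le D hε0 y.1).trans (Q.tapeProb_le_one D y.1)
    have hρ0 : 0 ≤ ρ := Q.ratio_nonneg D ε hμ y.1
    have hρ1 : ρ ≤ 1 := Q.ratio_le_one D ε hμ y.1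
    -- The equation `ρ (g + μ) = g` balances progress at rate `g` against surrender at rate `μ`.
    have hρμ : ρ * (g + μ) = g := div_mul_cancel₀ _ (by positivity)
    have hnn : 0 ≤ 1 + (A + B * (1 - ρ ^ (n + 1))) - B * (ρ ^ n - ρ ^ (n + 1)) * g := by
      have := mul_nonneg hB0 (one_sub_pow_sub_mul_nonneg hρ0 hρ1 hg1 n)
      linarith
    have hΔ : (ρ ^ n - ρ ^ (n + 1)) * g = μ * ρ ^ (n + 1) := by
      rw [pow_succ]
      linear_combination (-(ρ ^ n)) * hρμ
    calc _ ≤ ENNReal.ofReal 1 + (ENNReal.ofReal p * ENNReal.ofReal (B - 1) +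
          ENNReal.ofReal (1 - p) * ENNReal.ofReal
            (1 + (A + B * (1 - ρ ^ (n + 1))) - B * (ρ ^ n - ρ ^ (n + 1)) * g)) := by
          rw [ENNReal.ofReal_one]
          gcongr
          exact hfresh
      _ = ENNReal.ofReal (1 + (p * (B - 1) + (1 - p) *
            (1 + (A + B * (1 - ρ ^ (n + 1))) - B * (ρ ^ n - ρ ^ (n + 1)) * g))) := by
          rw [← ENNReal.ofReal_mul h0, ← ENNReal.ofReal_mul (by linarith),
            ← ENNReal.ofReal_add (mul_nonneg h0 (by linarith))
              (mul_nonneg (by linarith) hnn), ← ENNReal.ofReal_add zero_le_one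
              (add_nonneg (mul_nonneg h0 (by linarith)) (mul_nonneg (by linarith) hnn))]
      _ ≤ ENNReal.ofReal (A + B * (1 - ρ ^ (n + 1))) := by
          -- Equality holds: since `(1 - p) μ = p`, the terms with `B` cancel, and the rest is `2 (1
          -- - p) = p A`, that is, `A μ = 2`.
          refine ENNReal.ofReal_le_ofReal (le_of_eq ?_)
          have hpeq : p = μ / (1 + μ) := by rw [eq_div_iff (by positivity), hp]
          rw [mul_assoc B, hΔ, hpeq]
          field_simp
          linear_combination (-1 : ℝ) * hA

end Potential

/-! ### The bound -/

/-- A tape with large excess `g` is exploited with constant probability. -/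
theorem sub_mul_exp_le_mul_pow {g δ : ℝ} (hg : 0 ≤ g) (hδ : 0 < δ) {k : ℕ} (hk : 0 < k) :
    (g - δ / 2) * Real.exp (-1) ≤ g * (g / (g + δ / (2 * k))) ^ k := by
  have hk' : (0 : ℝ) < k := by exact_mod_cast hk
  rcases le_or_gt g (δ / 2) with h | h
  · have h1 : (g - δ / 2) * Real.exp (-1) ≤ 0 :=
      mul_nonpos_of_nonpos_of_nonneg (by linarith) (Real.exp_pos _).le
    exact h1.trans (by positivity)
  · have hg' : 0 < g := by linarith
    have hpow : Real.exp (-1) ≤ (g / (g + δ / (2 * k))) ^ k := by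
      -- From `g > δ / 2` follows `δ / (2k) ≤ g / k`; then use `1 + 1 / k ≤ exp (1 / k)`.
      have h2 : g + δ / (2 * k) ≤ g * Real.exp (1 / k) := by
        have h3 := mul_le_mul_of_nonneg_left (Real.add_one_le_exp (1 / (k : ℝ))) hg
        have h4 : δ / (2 * k) ≤ g * (1 / k) := by
          rw [div_le_iff₀ (by positivity)]
          field_simp
          linarith
        linarith
      have h5 : Real.exp (-(1 / k)) ≤ g / (g + δ / (2 * k)) := by
        rw [le_div_iff₀ (by positivity)]
        calc Real.exp (-(1 / k)) * (g + δ / (2 * k))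
            ≤ Real.exp (-(1 / k)) * (g * Real.exp (1 / k)) := by gcongr
          _ = g * (Real.exp (-(1 / k)) * Real.exp (1 / k)) := by ring
          _ = g := by rw [← Real.exp_add, neg_add_cancel, Real.exp_zero, mul_one]
      calc Real.exp (-1) = Real.exp (-(1 / k)) ^ k := by
            rw [← Real.exp_nat_mul]
            congr 1
            field_simp
        _ ≤ _ := pow_le_pow_left₀ (Real.exp_pos _).le h5 k
    calc (g - δ / 2) * Real.exp (-1) ≤ g * Real.exp (-1) := by gcongr; linarith
      _ ≤ _ := by gcongr

section Bound

variable {P : Params} {K L M : Type*} [Field K] [Field L] [Field M]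
  [Fintype K] [Fintype M] [Algebra K L] [Algebra L M] [Algebra K M]

/-- The average over the tapes of the cost of a new session. -/
theorem expect_session_le (D : PublicData P K L M) (Q : Prover P L M) {ε δ k : ℝ}
    (hk : k = (P.N - P.ℓ : ℕ)) (hε : 0 ≤ ε) (hδ : 0 < δ) (hQ : Q.acceptProb D = ε + δ) :
    𝔼 ω, ((1 - Q.tapeProb D ω) * (4 / δ * (1 + 8 * k / δ)) + Q.tapeProb D ω *
        (4 * k / δ + 4 / δ * (1 + 8 * k / δ) *
          (1 - Q.ratio D ε (δ / (2 * k)) ω ^ (P.N - P.ℓ + 1))) + 1 -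
        4 / δ * (1 + 8 * k / δ) * (Q.ratio D ε (δ / (2 * k)) ω ^ (P.N - P.ℓ) -
          Q.ratio D ε (δ / (2 * k)) ω ^ (P.N - P.ℓ + 1)) * Q.excess D ε ω) ≤
      4 / δ * (1 + 8 * k / δ) - 1 := by
  have hkN : 0 < P.N - P.ℓ := Nat.sub_pos_of_lt P.ℓ_lt_N
  have hk1 : 1 ≤ k := by rw [hk]; exact_mod_cast hkN
  have hk0 : 0 < k := by linarith
  have hμ : 0 < δ / (2 * k) := by positivity
  set A := 4 * k / δ with hA
  set B := 4 / δ * (1 + 8 * k / δ) with hB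
  have hA0 : 0 ≤ A := by positivity
  have hB0 : 0 ≤ B := by positivity
  have hmean : 𝔼 ω, Q.tapeProb D ω = ε + δ := by rw [← Prover.acceptProb_eq, hQ]
  have hle1 : ε + δ ≤ 1 := by
    rw [← hmean]
    exact Finset.expect_le Finset.univ_nonempty fun ω _ => Q.tapeProb_le_one D ω
  -- The terms with `ρ ^ (k + 1)` add up to something nonpositive because the excess is at most the
  -- acceptance probability. What remains has a bound affine in that probability, so only its mean
  -- `ε + δ` matters.
  have hpt : ∀ ω, (1 - Q.tapeProb D ω) * B + Q.tapeProb D ω *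
        (A + B * (1 - Q.ratio D ε (δ / (2 * k)) ω ^ (P.N - P.ℓ + 1))) + 1 -
        B * (Q.ratio D ε (δ / (2 * k)) ω ^ (P.N - P.ℓ) -
          Q.ratio D ε (δ / (2 * k)) ω ^ (P.N - P.ℓ + 1)) * Q.excess D ε ω ≤
      (B + 1 + B * ((ε + δ / 2) * Real.exp (-1))) +
        (A - B * Real.exp (-1)) * Q.tapeProb D ω := by
    intro ω
    have h1 := sub_mul_exp_le_mul_pow (Q.excess_nonneg D ε ω) hδ hkN
    rw [← hk] at h1
    change _ ≤ _ * Q.ratio D ε (δ / (2 * k)) ω ^ (P.N - P.ℓ) at h1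
    have h2 : (Q.tapeProb D ω - ε - δ / 2) * Real.exp (-1) ≤
        (Q.excess D ε ω - δ / 2) * Real.exp (-1) := by
      gcongr
      exact le_max_left _ _
    have h3 := mul_le_mul_of_nonneg_right (Q.excess_le D hε ω)
      (pow_nonneg (Q.ratio_nonneg D ε hμ ω) (P.N - P.ℓ + 1))
    have h4 := mul_le_mul_of_nonneg_left (h2.trans h1) hB0
    have h5 := mul_le_mul_of_nonneg_left h3 hB0
    linarith
  refine (Finset.expect_le_expect fun ω _ => hpt ω).trans ?_
  rw [Finset.expect_add_distrib, ← Finset.mul_expect, Fintype.expect_const, hmean]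
  have hexp : (1 / 2.7182818286 : ℝ) ≤ Real.exp (-1) := by
    rw [Real.exp_neg, one_div]
    exact inv_anti₀ (Real.exp_pos _) Real.exp_one_lt_d9.le
  have hx : 1 ≤ k / δ := by
    rw [one_le_div hδ]; linarith
  have hBδ : B * (δ / 2) = 2 * (1 + 8 * (k / δ)) := by
    rw [hB]; field_simp; ring
  have hA' : A = 4 * (k / δ) := by rw [hA]; ring
  have h6 : (ε + δ) * A ≤ A := by nlinarith
  -- With `x = k / δ ≥ 1` this reads `e (2 + 4x) ≤ 2 + 16x`; the constants in `B` leave room for it.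
  have h7 : 2 + A ≤ B * (δ / 2) * Real.exp (-1) := by
    rw [hBδ, hA']
    have : 2 * (1 + 8 * (k / δ)) * (1 / 2.7182818286) ≤
        2 * (1 + 8 * (k / δ)) * Real.exp (-1) := by gcongr
    refine le_trans ?_ this
    rw [mul_one_div, le_div_iff₀ (by norm_num)]
    linarith
  linarith

end Bound

end ThresholdRSD

end

open ThresholdRSD in
theorem mainTheorem4 (K L M : Type*) [Field K] [Field L] [Field M]
    [Fintype K] [Fintype L] [Fintype M] [Algebra K L] [Algebra L M] [Algebra K M]
    [IsScalarTower K L M] (P : Params) (D : PublicData P K L M) (ε ε' : ℝ)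
    (hε : ε = soundnessError P.N P.ℓ (falsePositiveRate K L M)) (hε' : ε < ε') :
    ∃ E : Extractor P L M, E.Correct D ∧
      ∀ Q : Prover P L M, Q.acceptProb D = ε' →
        E.expectedCalls Q ≤
          ENNReal.ofReal (4 / (ε' - ε) * (1 + 8 * ((P.N : ℝ) - P.ℓ) / (ε' - ε))) := by
  have hkN : 0 < P.N - P.ℓ := Nat.sub_pos_of_lt P.ℓ_lt_N
  have hk : (P.N : ℝ) - P.ℓ = (P.N - P.ℓ : ℕ) := (Nat.cast_sub P.ℓ_lt_N.le).symm
  have hk0 : (0 : ℝ) < (P.N : ℝ) - P.ℓ := by rw [hk]; exact_mod_cast hkN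
  have hk1 : (1 : ℝ) ≤ (P.N : ℝ) - P.ℓ := by rw [hk]; exact_mod_cast hkN
  have hδ : 0 < ε' - ε := sub_pos.2 hε'
  set k : ℝ := (P.N : ℝ) - P.ℓ with hkdef
  set δ : ℝ := ε' - ε with hδdef
  have hμ : 0 < δ / (2 * k) := by positivity
  have hp : δ / (2 * k) / (1 + δ / (2 * k)) * (1 + δ / (2 * k)) = δ / (2 * k) :=
    div_mul_cancel₀ _ (by positivity)
  have hε0 : 0 ≤ ε := by
    have := falsePositiveRate_nonneg (K := K) (L := L) (M := M)
    rw [hε, soundnessError]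
    positivity
  -- The surrender probability is `μ / (1 + μ)` with `μ = δ / (2k)`; it depends on the parameters
  -- and on `ε'`, but not on the prover.
  refine ⟨extractor D (δ / (2 * k) / (1 + δ / (2 * k))) (by positivity)
    (div_le_one_of_le₀ (by linarith) (by positivity)), extractor_correct D _ _ _, fun Q hQ => ?_⟩
  have hmean := expect_session_le D Q hk hε0 hδ (by rw [hQ]; ring)
  have hle1 : ε' ≤ 1 := by
    rw [← hQ, Prover.acceptProb_eq]
    exact Finset.expect_le Finset.univ_nonempty fun ω _ => Q.tapeProb_le_one D ω
  have hB : 1 ≤ 4 / δ * (1 + 8 * k / δ) := by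
    have h1 : 1 ≤ 4 / δ := by rw [one_le_div hδ]; linarith
    have h2 : 1 ≤ 1 + 8 * k / δ := by
      have : 0 ≤ 8 * k / δ := by positivity
      linarith
    nlinarith
  refine (Extractor.expectedCalls_le _ Q
    (potential D Q ε (δ / (2 * k)) (4 * k / δ) (4 / δ * (1 + 8 * k / δ))) (Reachable D Q)
    ⟨by simp, by simp, by simp, by simp⟩ (fun h hR _ ν hν x hx => hR.step hν hx)
    (fun h hR hout => one_add_mean_potential_le hμ (by field_simp; norm_num) hB hε hmean hp hR
      (extractor_out_eq_none.1 hout))).trans ?_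
  -- The potential of the empty list is at most `B`, the claimed bound.
  rw [potential]
  split_ifs
  · exact zero_le
  · exact le_rfl
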